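/- Let $(\mathsf C,\diamond,I,\star,J)$ be a duoidal (i.e. $2$-monoidal) category: a category with two monoidal structures, a natural interchange law $\zeta_{A,B,C,D}\colon (A\star B)\diamond(C\star D)\to(A\diamond C)\star(B\diamond D)$ and unit maps $I\to I\star I$, $J\diamond J\to J$, $I\to J$ (none of them required to be invertible) such that $\zeta$ is associative and unital with respect to both structures, $J$ is a monoid in $(\mathsf C,\diamond)$ and $I$ is a comonoid in $(\mathsf C,\star)$. Let $(\mathcal T,\varphi,\gamma)$ be a double monoidal monad on $\mathsf C$: a monad $\mathcal T$ on $\mathsf C$ with (lax) monoidal structures $\varphi$ on $\mathcal T$ for $\diamond$ and $\gamma$ on $\mathcal T$ for $\star$, such that the multiplication and the unit of the monad are monoidal transformations for both structures, and such that $\mathcal T$ is a double (lax) monoidal functor, that is, the two structures are compatible with $\zeta$ and with the three unit maps; explicitly, the compatibility with $\zeta$ is $$\gamma\circ(\varphi\star\varphi)\circ\zeta=\mathcal T\zeta\circ\varphi\circ(\gamma\diamond\gamma)\colon(\mathcal TA\star\mathcal TB)\diamond(\mathcal TC\star\mathcal TD)\to\mathcal T\bigl((A\diamond C)\star(B\diamond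 D)\bigr).$$ Assume that $\mathsf C$ admits reflexive coequalizers and that these are preserved by $\mathcal T\colon\mathsf C\to\mathsf C$ and by $\diamond,\star\colon\mathsf C\times\mathsf C\to\mathsf C$. For $\mathcal T$-algebras $(A,a)$, $(B,b)$, $(W,w)$, a map $f\colon A\diamond B\to W$ in $\mathsf C$ is called $(\mathcal T,\varphi)$-bilinear if $w\circ\mathcal Tf\circ\varphi_{A,B}=f\circ(a\diamond b)$, and such a map is universal if every $(\mathcal T,\varphi)$-bilinear map out of $A\diamond B$ factors through it by a unique morphism of algebras; similarly for $(\mathcal T,\gamma)$ and $\star$. Let $\mathsf C^{\mathcal T}$ be the category of $\mathcal T$-algebras and let $\mathcal F^{\mathcal T}\colon\mathsf C\to\mathsf C^{\mathcal T}$ be the free algebra functor. Then: (1) There are monoidal structures $(\diamond^{\varphi},\mathcal TI)$ and $(\star^{\gamma},\mathcal TJ)$ on $\mathsf C^{\mathcal T}$, whose units are the free algebras on $I$ and $J$, together with universal bilinear maps $v\colon A\diamond B\to A\diamond^{\varphi}B$ and $u\colon A\star B\to A\star^{\gamma}B$ which, along with $\eta_I\colon I\to\mathcal TI$ and $\eta_J\colon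 J\to\mathcal TJ$, make the forgetful functor $\mathsf C^{\mathcal T}\to\mathsf C$ (lax) monoidal for both structures. (2) For any such structures, $(\mathsf C^{\mathcal T},\diamond^{\varphi},\mathcal TI,\star^{\gamma},\mathcal TJ)$ is a duoidal category, with an interchange law $\zeta^{\mathcal T}$ such that $$\zeta^{\mathcal T}\circ v\circ(u\diamond u)=u\circ(v\star v)\circ\zeta\colon (A\star B)\diamond(C\star D)\to(A\diamond^{\varphi}C)\star^{\gamma}(B\diamond^{\varphi}D)$$ and with unit maps compatible in the same way with those of $\mathsf C$ (so that the forgetful functor is double lax monoidal). (3) With these structures, $\mathcal F^{\mathcal T}\colon(\mathsf C,\diamond,\star)\to(\mathsf C^{\mathcal T},\diamond^{\varphi},\star^{\gamma})$ is double strong monoidal: it is strong monoidal for $\diamond,\diamond^{\varphi}$ and for $\star,\star^{\gamma}$ by means of the isomorphisms $\mathcal F^{\mathcal T}X\diamond^{\varphi}\mathcal F^{\mathcal T}Y\to\mathcal F^{\mathcal T}(X\diamond Y)$ and $\mathcal F^{\mathcal T}X\star^{\gamma}\mathcal F^{\mathcal T}Y\to\mathcal F^{\mathcal T}(X\star Y)$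 induced by $\varphi_{X,Y}$ and $\gamma_{X,Y}$ and the unit isomorphisms induced by $\varphi_0$ and $\gamma_0$, and these are compatible with the interchange laws and the unit maps. -/

import Mathlib

open CategoryTheory CategoryTheory.Limits

universe v u v' u'

/- Several monoidal structures live on the same category, so a monoidal structure is always an
explicit argument. The tensor product of objects and of morphisms for the structure `M`: -/
notation:70 A:71 "⊠[" M "]" B:71 => MonoidalCategoryStruct.tensorObj (self := MonoidalCategory.toMonoidalCategoryStruct (self := M)) A B
notation:70 f:71 "⊠ₘ[" M "]" g:71 => MonoidalCategoryStruct.tensorHom (self := MonoidalCategory.toMonoidalCategoryStruct (self := M)) f g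

/-- The unit object of the monoidal structure `M`. -/
abbrev unitOf {C : Type u} [Category.{v} C] (M : MonoidalCategory C) : C :=
  M.tensorUnit

/-- A duoidal (that is, 2-monoidal) structure on a category with two monoidal structures:
`M = (⋄, I)` and `N = (⋆, J)`, in this order. -/
structure DuoidalStr {C : Type u} [Category.{v} C] (M N : MonoidalCategory C) where
  /-- the interchange law `(A ⋆ B) ⋄ (X ⋆ Y) ⟶ (A ⋄ X) ⋆ (B ⋄ Y)` -/
  ζ (A B X Y : C) : (A ⊠[N] B) ⊠[M] (X ⊠[N] Y) ⟶ (A ⊠[M] X) ⊠[N] (B ⊠[M] Y)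
  /-- the unit map `I ⟶ I ⋆ I` -/
  δ : unitOf M ⟶ unitOf M ⊠[N] unitOf M
  /-- the unit map `J ⋄ J ⟶ J` -/
  θ : unitOf N ⊠[M] unitOf N ⟶ unitOf N
  /-- the unit map `I ⟶ J` -/
  ι : unitOf M ⟶ unitOf N
  ζ_natural {A A' B B' X X' Y Y' : C}
      (f : A ⟶ A') (g : B ⟶ B') (h : X ⟶ X') (k : Y ⟶ Y') :
    ((f ⊠ₘ[N] g) ⊠ₘ[M] (h ⊠ₘ[N] k)) ≫ ζ A' B' X' Y' =
      ζ A B X Y ≫ ((f ⊠ₘ[M] h) ⊠ₘ[N] (g ⊠ₘ[M] k))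
  /-- associativity of the interchange law with respect to `⋄` -/
  ζ_assoc_fst (A X B Y Z W : C) :
    (ζ A X B Y ⊠ₘ[M] 𝟙 (Z ⊠[N] W)) ≫ ζ (A ⊠[M] B) (X ⊠[M] Y) Z W ≫
        ((M.associator A B Z).hom ⊠ₘ[N] (M.associator X Y W).hom) =
      (M.associator (A ⊠[N] X) (B ⊠[N] Y) (Z ⊠[N] W)).hom ≫
        (𝟙 (A ⊠[N] X) ⊠ₘ[M] ζ B Y Z W) ≫ ζ A X (B ⊠[M] Z) (Y ⊠[M] W)
  /-- associativity of the interchange law with respect to `⋆` -/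
  ζ_assoc_snd (A B Z X Y W : C) :
    ζ (A ⊠[N] B) Z (X ⊠[N] Y) W ≫ (ζ A B X Y ⊠ₘ[N] 𝟙 (Z ⊠[M] W)) ≫
        (N.associator (A ⊠[M] X) (B ⊠[M] Y) (Z ⊠[M] W)).hom =
      ((N.associator A B Z).hom ⊠ₘ[M] (N.associator X Y W).hom) ≫
        ζ A (B ⊠[N] Z) X (Y ⊠[N] W) ≫ (𝟙 (A ⊠[M] X) ⊠ₘ[N] ζ B Z Y W)
  /-- unitality of the interchange law with respect to `I` -/
  ζ_left_unit_fst (A B : C) :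
    (δ ⊠ₘ[M] 𝟙 (A ⊠[N] B)) ≫ ζ (unitOf M) (unitOf M) A B ≫
      ((M.leftUnitor A).hom ⊠ₘ[N] (M.leftUnitor B).hom) = (M.leftUnitor (A ⊠[N] B)).hom
  ζ_right_unit_fst (A B : C) :
    (𝟙 (A ⊠[N] B) ⊠ₘ[M] δ) ≫ ζ A B (unitOf M) (unitOf M) ≫
      ((M.rightUnitor A).hom ⊠ₘ[N] (M.rightUnitor B).hom) = (M.rightUnitor (A ⊠[N] B)).hom
  /-- unitality of the interchange law with respect to `J` -/
  ζ_left_unit_snd (A B : C) :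
    ζ (unitOf N) A (unitOf N) B ≫ (θ ⊠ₘ[N] 𝟙 (A ⊠[M] B)) ≫ (N.leftUnitor (A ⊠[M] B)).hom =
      (N.leftUnitor A).hom ⊠ₘ[M] (N.leftUnitor B).hom
  ζ_right_unit_snd (A B : C) :
    ζ A (unitOf N) B (unitOf N) ≫ (𝟙 (A ⊠[M] B) ⊠ₘ[N] θ) ≫ (N.rightUnitor (A ⊠[M] B)).hom =
      (N.rightUnitor A).hom ⊠ₘ[M] (N.rightUnitor B).hom
  /-- `(J, θ, ι)` is a monoid for `⋄` -/
  θ_assoc : (θ ⊠ₘ[M] 𝟙 (unitOf N)) ≫ θ =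
    (M.associator (unitOf N) (unitOf N) (unitOf N)).hom ≫ (𝟙 (unitOf N) ⊠ₘ[M] θ) ≫ θ
  ι_θ : (ι ⊠ₘ[M] 𝟙 (unitOf N)) ≫ θ = (M.leftUnitor (unitOf N)).hom
  θ_ι : (𝟙 (unitOf N) ⊠ₘ[M] ι) ≫ θ = (M.rightUnitor (unitOf N)).hom
  /-- `(I, δ, ι)` is a comonoid for `⋆` -/
  δ_coassoc : δ ≫ (δ ⊠ₘ[N] 𝟙 (unitOf M)) ≫
      (N.associator (unitOf M) (unitOf M) (unitOf M)).hom =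
    δ ≫ (𝟙 (unitOf M) ⊠ₘ[N] δ)
  δ_ι_left : δ ≫ (ι ⊠ₘ[N] 𝟙 (unitOf M)) ≫ (N.leftUnitor (unitOf M)).hom = 𝟙 (unitOf M)
  δ_ι_right : δ ≫ (𝟙 (unitOf M) ⊠ₘ[N] ι) ≫ (N.rightUnitor (unitOf M)).hom = 𝟙 (unitOf M)

/-- A monoidal structure (lax, not necessarily invertible) on a functor
from `(C, M)` to `(D, M')`. -/
abbrev LaxStr {C : Type u} [Category.{v} C] {D : Type u'} [Category.{v'} D]
    (M : MonoidalCategory C) (M' : MonoidalCategory D) (F : C ⥤ D) :=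
  Functor.LaxMonoidal F

/-- A strong monoidal structure on a functor from `(C, M)` to `(D, M')`. -/
abbrev StrongStr {C : Type u} [Category.{v} C] {D : Type u'} [Category.{v'} D]
    (M : MonoidalCategory C) (M' : MonoidalCategory D) (F : C ⥤ D) :=
  Functor.Monoidal F

/-- The functor `F` between duoidal categories, with monoidal structures `φ` for the first and
`γ` for the second tensor products, is a double (lax) monoidal functor. -/
structure IsDoubleMonoidal {C : Type u} [Category.{v} C] {D : Type u'} [Category.{v'} D]
    {M N : MonoidalCategory C} {M' N' : MonoidalCategory D}
    (X : DuoidalStr M N) (Y : DuoidalStr M' N') (F : C ⥤ D)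
    (φ : LaxStr M M' F) (γ : LaxStr N N' F) : Prop where
  interchange (A B A' B' : C) :
    (γ.μ A B ⊠ₘ[M'] γ.μ A' B') ≫ φ.μ (A ⊠[N] B) (A' ⊠[N] B') ≫ F.map (X.ζ A B A' B') =
      Y.ζ (F.obj A) (F.obj B) (F.obj A') (F.obj B') ≫
        (φ.μ A A' ⊠ₘ[N'] φ.μ B B') ≫ γ.μ (A ⊠[M] A') (B ⊠[M] B')
  unit_δ : φ.ε ≫ F.map X.δ = Y.δ ≫ (φ.ε ⊠ₘ[N'] φ.ε) ≫ γ.μ (unitOf M) (unitOf M)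
  unit_θ : (γ.ε ⊠ₘ[M'] γ.ε) ≫ φ.μ (unitOf N) (unitOf N) ≫ F.map X.θ = Y.θ ≫ γ.ε
  unit_ι : φ.ε ≫ F.map X.ι = Y.ι ≫ γ.ε

/-- The structure of a monoidal monad on `T`, with respect to the monoidal structure `M`. -/
structure MonoidalMonadStr {C : Type u} [Category.{v} C]
    (M : MonoidalCategory C) (T : Monad C) where
  lax : LaxStr M M T.toFunctor
  η_monoidal : NatTrans.IsMonoidal T.η
  μ_monoidal : NatTrans.IsMonoidal T.μ

/-- The structure of a double monoidal monad on `T`. -/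
structure DoubleMonoidalMonadStr {C : Type u} [Category.{v} C] {M N : MonoidalCategory C}
    (X : DuoidalStr M N) (T : Monad C) where
  φ : MonoidalMonadStr M T
  γ : MonoidalMonadStr N T
  isDoubleMonoidal : IsDoubleMonoidal X X T.toFunctor φ.lax γ.lax

section

variable {C : Type u} [Category.{v} C] {M : MonoidalCategory C} {T : Monad C}

/-- A map `f : A ⊗ B ⟶ W` in `C`, where `A`, `B`, `W` are `T`-algebras, is `(T, φ)`-bilinear. -/
def IsBilinear (φ : MonoidalMonadStr M T) {A B W : T.Algebra} (f : A.A ⊠[M] B.A ⟶ W.A) : Prop :=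
  φ.lax.μ A.A B.A ≫ T.map f ≫ W.a = (A.a ⊠ₘ[M] B.a) ≫ f

/-- A `(T, φ)`-bilinear map is universal if every `(T, φ)`-bilinear map with the same domain
factors through it by a unique morphism of algebras. -/
def IsUniversalBilinear (φ : MonoidalMonadStr M T) {A B U : T.Algebra}
    (u : A.A ⊠[M] B.A ⟶ U.A) : Prop :=
  IsBilinear φ u ∧
    ∀ (W : T.Algebra) (f : A.A ⊠[M] B.A ⟶ W.A), IsBilinear φ f → ∃! g : U ⟶ W, u ≫ g.f = f

/-- The monoidal structure `⊗^φ` on the category of algebras over a monoidal monad: its tensor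
product is the target of universal bilinear maps `A ⊗ B ⟶ A ⊗^φ B`, its unit object is the free
algebra `T I`, and its action on morphisms, associator and unitors are those induced from `C`
through the universal maps. The last condition says that the universal maps `A ⊗ B ⟶ A ⊗^φ B`
and `η : I ⟶ T I` make the forgetful functor monoidal. -/
structure AlgTensor (φ : MonoidalMonadStr M T) where
  mon : MonoidalCategory T.Algebra
  lax : LaxStr mon M T.forget
  universal (A B : T.Algebra) : IsUniversalBilinear φ (U := A ⊠[mon] B) (lax.μ A B)
  unit_eq : unitOf mon = T.free.obj (unitOf M)
  ε_eq : lax.ε ≫ (eqToHom unit_eq).f = T.η.app (unitOf M)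

/-- A strong monoidal structure on the free algebra functor is the canonical one if its structure
maps are those induced by `φ_{X,Y} : T X ⊗ T Y ⟶ T (X ⊗ Y)` and `φ_0 : I ⟶ T I` through the
universal maps. -/
structure IsCanonicalFree {φ : MonoidalMonadStr M T} (P : AlgTensor φ)
    (Φ : StrongStr M P.mon T.free) : Prop where
  μ_eq (X Y : C) :
    P.lax.μ (T.free.obj X) (T.free.obj Y) ≫ (Φ.μ X Y).f = φ.lax.μ X Y
  ε_eq : P.lax.ε ≫ (Φ.ε).f = φ.lax.ε

end

/-! Algebras are handled by generators and relations. A presentation of `A` exhibits the map `T X ⟶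
A` extending `p : X ⟶ A` as the coequalizer, in `C`, of the reflexive pair of Kleisli extensions `T
R ⇉ T X`. Every algebra presents itself (the canonical resolution `T T A ⇉ T A`). A free algebra is
presented by its unit map. The tensor product of `A` and `B` is presented by the generators `A ⊗ B`
and the relation that identifies `a ⊗ b` with `φ`. Since `T` preserves reflexive coequalizers, the
coequalizer of this last pair in `C` is again an algebra.

Existence of morphisms: the tensor product preserves reflexive coequalizers in both variables
jointly, so tensoring two presentations gives a coequalizer again. A map on the tensor product of
the generators that respects the relations therefore extends to a bilinear map
(`IsPresentation.exists_bilinear`), hence to a morphism out of the tensor product of algebras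
(`IsPresentation.exists_hom_tensor`). The condition to be checked is in each case an axiom on `T`:
associativity of `φ` for the associator, its unitality for the unitors, compatibility of `φ` and `γ`
with `ζ` for the interchange law.

Uniqueness: morphisms out of an iterated tensor product are determined by the iterated tensor
product of the generators (`Generates.tensor`). Composites of coequalizers need not be coequalizers,
but composites of epimorphisms are epimorphisms. This is why `Generates` asks only for epimorphisms,
yet after every functor that preserves reflexive coequalizers: the condition then survives tensoring
and applying `T`. Each coherence law for algebras, restricted to generators, becomes the same law in
`C`.

For free algebras, `φ : T X ⊗ T Y ⟶ T (X ⊗ Y)` is itself universal bilinear. This makes the free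
functor strong monoidal, and its compatibility with the interchange laws is that of `T`, read on
generators. -/

/-! ### Reflexive coequalizers -/

section

variable {C : Type u} [Category.{v} C]

/-- The morphism `q` is a coequalizer of the reflexive pair `f`, `g`. -/
structure IsReflCoeq {X Y Z : C} (f g : X ⟶ Y) (q : Y ⟶ Z) : Prop where
  exists_section : ∃ s, s ≫ f = 𝟙 Y ∧ s ≫ g = 𝟙 Y
  w : f ≫ q = g ≫ q
  exists_desc {W : C} (k : Y ⟶ W) : f ≫ k = g ≫ k → ∃ l, q ≫ l = k
  epi : Epi q

namespace IsReflCoeq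

variable {X Y Z : C} {f g : X ⟶ Y} {q : Y ⟶ Z}

theorem isReflexivePair (h : IsReflCoeq f g q) : IsReflexivePair f g :=
  ⟨h.exists_section⟩

theorem nonempty_isColimit (h : IsReflCoeq f g q) :
    Nonempty (IsColimit (Cofork.ofπ q h.w)) := by
  have := h.epi
  exact ⟨Cofork.IsColimit.mk _ (fun s => (h.exists_desc s.π s.condition).choose)
    (fun s => (h.exists_desc s.π s.condition).choose_spec)
    (fun s m hm => by
      rw [← cancel_epi q]
      exact hm.trans (h.exists_desc s.π s.condition).choose_spec.symm)⟩

theorem of_isColimit (h : IsReflexivePair f g) (w : f ≫ q = g ≫ q)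
    (hq : IsColimit (Cofork.ofπ q w)) : IsReflCoeq f g q where
  exists_section := h.common_section'
  w := w
  exists_desc k hk := ⟨_, (Cofork.IsColimit.desc' hq k hk).2⟩
  epi := ⟨fun _ _ h => Cofork.IsColimit.hom_ext hq h⟩

theorem refl (X : C) : IsReflCoeq (𝟙 X) (𝟙 X) (𝟙 X) where
  exists_section := ⟨𝟙 X, by simp⟩
  w := rfl
  exists_desc k _ := ⟨k, by simp⟩
  epi := inferInstance

/-- Reduces joint preservation by a tensor product to preservation by a functor on `C × C`. -/
theorem prod {X' Y' Z' : C} {f' g' : X' ⟶ Y'} {q' : Y' ⟶ Z'} (h : IsReflCoeq f g q)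
    (h' : IsReflCoeq f' g' q') :
    IsReflCoeq (C := C × C) (X := (X, X')) (Y := (Y, Y')) (Z := (Z, Z')) (f, f') (g, g') (q,
      q') where
  exists_section := by
    obtain ⟨s, h1, h2⟩ := h.exists_section
    obtain ⟨s', h1', h2'⟩ := h'.exists_section
    exact ⟨(s, s'), Prod.ext h1 h1', Prod.ext h2 h2'⟩
  w := Prod.ext h.w h'.w
  exists_desc k hk := by
    obtain ⟨l, hl⟩ := h.exists_desc k.1 (congrArg Prod.fst hk)
    obtain ⟨l', hl'⟩ := h'.exists_desc k.2 (congrArg Prod.snd hk)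
    exact ⟨(l, l'), Prod.ext hl hl'⟩
  epi := ⟨fun a b hab => by
    have := h.epi
    have := h'.epi
    exact Prod.ext ((cancel_epi q).1 (congrArg Prod.fst hab))
      ((cancel_epi q').1 (congrArg Prod.snd hab))⟩

theorem map {D : Type u'} [Category.{v} D] {F : C ⥤ D}
    (hF : Monad.PreservesColimitOfIsReflexivePair F) (h : IsReflCoeq f g q) :
    IsReflCoeq (F.map f) (F.map g) (F.map q) := by
  have := h.isReflexivePair
  have : IsReflexivePair (F.map f) (F.map g) := by
    obtain ⟨s, h1, h2⟩ := h.exists_section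
    exact ⟨F.map s, by rw [← F.map_comp, h1, F.map_id], by rw [← F.map_comp, h2, F.map_id]⟩
  exact of_isColimit this _ (isColimitCoforkMapOfIsColimit F h.w h.nonempty_isColimit.some)

theorem comp_iso (h : IsReflCoeq f g q) {Z' : C} (e : Z ≅ Z') : IsReflCoeq f g (q ≫ e.hom) where
  exists_section := h.exists_section
  w := by rw [reassoc_of% h.w]
  exists_desc k hk := by
    obtain ⟨l, hl⟩ := h.exists_desc k hk
    exact ⟨e.inv ≫ l, by simpa using hl⟩
  epi := by
    have := h.epi
    infer_instance

theorem exists_of_hasReflexiveCoequalizers (hC : HasReflexiveCoequalizers C) (f g : X ⟶ Y)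
    (h : IsReflexivePair f g) : ∃ (Z : C) (q : Y ⟶ Z), IsReflCoeq f g q := by
  have := hC.has_coeq f g
  exact ⟨coequalizer f g, coequalizer.π f g,
    of_isColimit h (coequalizer.condition f g) (coequalizerIsCoequalizer f g)⟩

end IsReflCoeq

/-- The endofunctor `F` preserves reflexive coequalizers. -/
def PreservesReflCoeq (F : C ⥤ C) : Prop :=
  ∀ ⦃X Y Z : C⦄ ⦃f g : X ⟶ Y⦄ ⦃q : Y ⟶ Z⦄, IsReflCoeq f g q →
    IsReflCoeq (F.map f) (F.map g) (F.map q)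

/-- The tensor product of `M` preserves reflexive coequalizers. -/
def PreservesReflCoeq₂ (M : MonoidalCategory C) : Prop :=
  ∀ ⦃X Y Z X' Y' Z' : C⦄ ⦃f g : X ⟶ Y⦄ ⦃q : Y ⟶ Z⦄ ⦃f' g' : X' ⟶ Y'⦄ ⦃q' : Y' ⟶ Z'⦄,
    IsReflCoeq f g q → IsReflCoeq f' g' q' →
    IsReflCoeq (f ⊠ₘ[M] f') (g ⊠ₘ[M] g') (q ⊠ₘ[M] q')

theorem preservesReflCoeq_of_preservesColimit {F : C ⥤ C}
    (hF : Monad.PreservesColimitOfIsReflexivePair F) : PreservesReflCoeq F :=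
  fun _ _ _ _ _ _ h => h.map hF

theorem preservesReflCoeq₂_of_preservesColimit {M : MonoidalCategory C}
    (hM : Monad.PreservesColimitOfIsReflexivePair (@MonoidalCategory.tensor C _ M)) :
    PreservesReflCoeq₂ M :=
  fun _ _ _ _ _ _ _ _ _ _ _ _ h h' => (h.prod h').map hM

/-! ### Functoriality of an explicit tensor product -/

section

variable {M : MonoidalCategory C}

theorem mtensor_comp {A B X A' B' X' : C} (f : A ⟶ B) (g : B ⟶ X) (f' : A' ⟶ B') (g' : B' ⟶ X') :
    (f ⊠ₘ[M] f') ≫ (g ⊠ₘ[M] g') = (f ≫ g) ⊠ₘ[M] (f' ≫ g') :=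
  MonoidalCategory.tensorHom_comp_tensorHom f f' g g'

theorem mtensor_comp_assoc {A B X A' B' X' Y : C} (f : A ⟶ B) (g : B ⟶ X) (f' : A' ⟶ B')
    (g' : B' ⟶ X') (k : X ⊠[M] X' ⟶ Y) :
    (f ⊠ₘ[M] f') ≫ (g ⊠ₘ[M] g') ≫ k = ((f ≫ g) ⊠ₘ[M] (f' ≫ g')) ≫ k := by
  rw [← Category.assoc, mtensor_comp]

theorem mtensor_id (A B : C) : (𝟙 A) ⊠ₘ[M] (𝟙 B) = 𝟙 (A ⊠[M] B) :=
  MonoidalCategory.id_tensorHom_id A B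

theorem massociator_naturality {X₁ X₂ X₃ Y₁ Y₂ Y₃ : C} (f₁ : X₁ ⟶ Y₁) (f₂ : X₂ ⟶ Y₂)
    (f₃ : X₃ ⟶ Y₃) :
    ((f₁ ⊠ₘ[M] f₂) ⊠ₘ[M] f₃) ≫ (M.associator Y₁ Y₂ Y₃).hom =
      (M.associator X₁ X₂ X₃).hom ≫ (f₁ ⊠ₘ[M] (f₂ ⊠ₘ[M] f₃)) :=
  MonoidalCategory.associator_naturality f₁ f₂ f₃

theorem massociator_inv_naturality {X₁ X₂ X₃ Y₁ Y₂ Y₃ : C} (f₁ : X₁ ⟶ Y₁) (f₂ : X₂ ⟶ Y₂)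
    (f₃ : X₃ ⟶ Y₃) :
    (f₁ ⊠ₘ[M] (f₂ ⊠ₘ[M] f₃)) ≫ (M.associator Y₁ Y₂ Y₃).inv =
      (M.associator X₁ X₂ X₃).inv ≫ ((f₁ ⊠ₘ[M] f₂) ⊠ₘ[M] f₃) :=
  MonoidalCategory.associator_inv_naturality f₁ f₂ f₃

theorem mleftUnitor_naturality {X Y : C} (f : X ⟶ Y) :
    (𝟙 (unitOf M) ⊠ₘ[M] f) ≫ (M.leftUnitor Y).hom = (M.leftUnitor X).hom ≫ f := by
  rw [MonoidalCategory.id_tensorHom]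
  exact MonoidalCategory.leftUnitor_naturality f

theorem mrightUnitor_naturality {X Y : C} (f : X ⟶ Y) :
    (f ⊠ₘ[M] 𝟙 (unitOf M)) ≫ (M.rightUnitor Y).hom = (M.rightUnitor X).hom ≫ f := by
  rw [MonoidalCategory.tensorHom_id]
  exact MonoidalCategory.rightUnitor_naturality f

theorem mpentagon (W X Y Z : C) :
    ((M.associator W X Y).hom ⊠ₘ[M] 𝟙 Z) ≫ (M.associator W (X ⊠[M] Y) Z).hom ≫
        (𝟙 W ⊠ₘ[M] (M.associator X Y Z).hom) =
      (M.associator (W ⊠[M] X) Y Z).hom ≫ (M.associator W X (Y ⊠[M] Z)).hom := by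
  rw [MonoidalCategory.tensorHom_id, MonoidalCategory.id_tensorHom]
  exact MonoidalCategory.pentagon W X Y Z

theorem mtriangle (X Y : C) :
    (M.associator X (unitOf M) Y).hom ≫ (𝟙 X ⊠ₘ[M] (M.leftUnitor Y).hom) =
      (M.rightUnitor X).hom ⊠ₘ[M] 𝟙 Y := by
  rw [MonoidalCategory.tensorHom_id, MonoidalCategory.id_tensorHom]
  exact MonoidalCategory.triangle X Y

/-- Pair the given coequalizer with the trivial one on `Y`. -/
theorem PreservesReflCoeq₂.tensorRight (hM : PreservesReflCoeq₂ M) (Y : C) :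
    PreservesReflCoeq (MonoidalCategory.tensorRight Y) := by
  intro X₁ X₂ X₃ f g q h
  have := hM h (.refl Y)
  rw [MonoidalCategory.tensorHom_id, MonoidalCategory.tensorHom_id,
    MonoidalCategory.tensorHom_id] at this
  exact this

theorem PreservesReflCoeq₂.tensorLeft (hM : PreservesReflCoeq₂ M) (Y : C) :
    PreservesReflCoeq (MonoidalCategory.tensorLeft Y) := by
  intro X₁ X₂ X₃ f g q h
  have := hM (.refl Y) h
  rw [MonoidalCategory.id_tensorHom, MonoidalCategory.id_tensorHom,
    MonoidalCategory.id_tensorHom] at this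
  exact this

end

/-! ### Lax monoidal functors with explicit structures -/

section

variable {D : Type u'} [Category.{v'} D] {M : MonoidalCategory C} {M' : MonoidalCategory D}
  {F : C ⥤ D} (L : LaxStr M M' F)

namespace LaxStr

theorem natural {X Y X' Y' : C} (f : X ⟶ Y) (g : X' ⟶ Y') :
    (F.map f ⊠ₘ[M'] F.map g) ≫ L.μ Y Y' = L.μ X X' ≫ F.map (f ⊠ₘ[M] g) :=
  @Functor.LaxMonoidal.μ_natural C _ M D _ M' F L _ _ _ _ f g

theorem assoc (X Y Z : C) :
    (L.μ X Y ⊠ₘ[M'] 𝟙 (F.obj Z)) ≫ L.μ (X ⊠[M] Y) Z ≫ F.map (M.associator X Y Z).hom =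
      (M'.associator (F.obj X) (F.obj Y) (F.obj Z)).hom ≫ (𝟙 (F.obj X) ⊠ₘ[M'] L.μ Y Z) ≫
        L.μ X (Y ⊠[M] Z) := by
  rw [MonoidalCategory.tensorHom_id, MonoidalCategory.id_tensorHom]
  exact L.associativity X Y Z

theorem left_unit (X : C) :
    (L.ε ⊠ₘ[M'] 𝟙 (F.obj X)) ≫ L.μ (unitOf M) X ≫ F.map (M.leftUnitor X).hom =
      (M'.leftUnitor (F.obj X)).hom := by
  rw [MonoidalCategory.tensorHom_id]
  exact (L.left_unitality X).symm

theorem right_unit (X : C) :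
    (𝟙 (F.obj X) ⊠ₘ[M'] L.ε) ≫ L.μ X (unitOf M) ≫ F.map (M.rightUnitor X).hom =
      (M'.rightUnitor (F.obj X)).hom := by
  rw [MonoidalCategory.id_tensorHom]
  exact (L.right_unitality X).symm

end LaxStr

end

end

/-! ### Monoidal monads, and algebras by generators and relations -/

section

variable {C : Type u} [Category.{v} C] {M : MonoidalCategory C} {T : Monad C}

namespace MonoidalMonadStr

variable (φ : MonoidalMonadStr M T)

theorem ε_eq : φ.lax.ε = T.η.app (unitOf M) := by
  have h := φ.η_monoidal.unit
  exact h.symm.trans (Category.id_comp _)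

theorem η_tensor (X Y : C) :
    (T.η.app X ⊠ₘ[M] T.η.app Y) ≫ φ.lax.μ X Y = T.η.app (X ⊠[M] Y) := by
  have h := φ.η_monoidal.tensor X Y
  exact h.symm.trans (Category.id_comp _)

theorem η_tensor_assoc (X Y : C) {Z : C} (k : T.obj (X ⊠[M] Y) ⟶ Z) :
    (T.η.app X ⊠ₘ[M] T.η.app Y) ≫ φ.lax.μ X Y ≫ k = T.η.app (X ⊠[M] Y) ≫ k := by
  rw [← φ.η_tensor, Category.assoc]

theorem μ_tensor (X Y : C) :
    (T.μ.app X ⊠ₘ[M] T.μ.app Y) ≫ φ.lax.μ X Y =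
      φ.lax.μ (T.obj X) (T.obj Y) ≫ T.map (φ.lax.μ X Y) ≫ T.μ.app (X ⊠[M] Y) := by
  have h := φ.μ_monoidal.tensor X Y
  exact h.symm.trans (Category.assoc _ _ _)

theorem μ_tensor_assoc (X Y : C) {Z : C} (k : T.obj (X ⊠[M] Y) ⟶ Z) :
    (T.μ.app X ⊠ₘ[M] T.μ.app Y) ≫ φ.lax.μ X Y ≫ k =
      φ.lax.μ (T.obj X) (T.obj Y) ≫ T.map (φ.lax.μ X Y) ≫ T.μ.app (X ⊠[M] Y) ≫ k := by
  rw [← Category.assoc, μ_tensor]; simp only [Category.assoc]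

theorem natural_assoc {X Y X' Y' Z : C} (f : X ⟶ Y) (g : X' ⟶ Y') (k : T.obj (Y ⊠[M] Y') ⟶ Z) :
    (T.map f ⊠ₘ[M] T.map g) ≫ φ.lax.μ Y Y' ≫ k =
      φ.lax.μ X X' ≫ T.map (f ⊠ₘ[M] g) ≫ k := by
  have h := φ.lax.natural f g
  rw [← Category.assoc]; exact (h =≫ k).trans (Category.assoc _ _ _)

end MonoidalMonadStr

theorem monad_η_naturality_assoc {X Y Z : C} (f : X ⟶ Y) (k : T.obj Y ⟶ Z) :
    f ≫ T.η.app Y ≫ k = T.η.app X ≫ T.map f ≫ k := T.η.naturality_assoc f k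

theorem monad_μ_naturality_assoc {X Y Z : C} (f : X ⟶ Y) (k : T.obj Y ⟶ Z) :
    T.map (T.map f) ≫ T.μ.app Y ≫ k = T.μ.app X ≫ T.map f ≫ k := T.μ.naturality_assoc f k

/-- The Kleisli extension `T R ⟶ T X` of `r : R ⟶ T X`. -/
def kleisliLift {R X : C} (r : R ⟶ T.obj X) : T.obj R ⟶ T.obj X := T.map r ≫ T.μ.app X

/-- The map `T X ⟶ A` underlying the morphism of algebras induced by `p : X ⟶ A`. -/
def freeLift (A : T.Algebra) {X : C} (p : X ⟶ A.A) : T.obj X ⟶ A.A := T.map p ≫ A.a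

theorem map_freeLift_a {A : T.Algebra} {X : C} (p : X ⟶ A.A) :
    T.map (freeLift A p) ≫ A.a = T.μ.app X ≫ freeLift A p := by
  unfold freeLift
  rw [T.map_comp, Category.assoc, ← A.assoc, monad_μ_naturality_assoc]

theorem map_freeLift_a_assoc {A : T.Algebra} {X Z : C} (p : X ⟶ A.A) (k : A.A ⟶ Z) :
    T.map (freeLift A p) ≫ A.a ≫ k = T.μ.app X ≫ freeLift A p ≫ k := by
  rw [← Category.assoc, map_freeLift_a, Category.assoc]

theorem η_freeLift (A : T.Algebra) {X : C} (p : X ⟶ A.A) :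
    T.η.app X ≫ freeLift A p = p := by
  unfold freeLift
  rw [← monad_η_naturality_assoc, A.unit, Category.comp_id]

theorem freeLift_comp {A B : T.Algebra} {X : C} (p : X ⟶ A.A) (g : A ⟶ B) :
    freeLift A p ≫ g.f = freeLift B (p ≫ g.f) := by
  unfold freeLift
  rw [T.map_comp, Category.assoc, Category.assoc, g.h]

/-- Consequently an equation between maps out of `T R` of this kind need only be checked on the
relations `R`. -/
theorem kleisliLift_freeLift {A : T.Algebra} {R X : C} (r : R ⟶ T.obj X) (p : X ⟶ A.A) :
    kleisliLift r ≫ freeLift A p = freeLift A (r ≫ freeLift A p) := by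
  unfold kleisliLift
  rw [Category.assoc, ← map_freeLift_a, ← T.map_comp_assoc]
  rfl

theorem kleisliLift_η (X : C) : kleisliLift (T.η.app X) = 𝟙 (T.obj X) := T.right_unit X

/-- The algebra `A` is presented by the generators `p : X ⟶ A` and the relations
`r s : R ⟶ T X`. -/
def IsPresentation (A : T.Algebra) {R X : C} (r s : R ⟶ T.obj X) (p : X ⟶ A.A) : Prop :=
  IsReflCoeq (kleisliLift r) (kleisliLift s) (freeLift A p)

/-- The map `p : X ⟶ A` generates the algebra `A`, in the sense that the induced map `T X ⟶ A`
is sent to an epimorphism by the functors that preserve reflexive coequalizers. -/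
def Generates (A : T.Algebra) {X : C} (p : X ⟶ A.A) : Prop :=
  ∀ ⦃F : C ⥤ C⦄, PreservesReflCoeq F → Epi (F.map (freeLift A p))

theorem PreservesReflCoeq.id : PreservesReflCoeq (𝟭 C) := fun _ _ _ _ _ _ h => h

theorem PreservesReflCoeq.comp {F G : C ⥤ C} (hF : PreservesReflCoeq F)
    (hG : PreservesReflCoeq G) : PreservesReflCoeq (F ⋙ G) :=
  fun _ _ _ _ _ _ h => hG (hF h)

theorem IsPresentation.generates {A : T.Algebra} {R X : C} {r s : R ⟶ T.obj X} {p : X ⟶ A.A}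
    (h : IsPresentation A r s p) : Generates A p := fun _ hF => (hF h).epi

theorem Generates.epi {A : T.Algebra} {X : C} {p : X ⟶ A.A} (h : Generates A p) :
    Epi (freeLift A p) := h .id

theorem Generates.hom_ext {A B : T.Algebra} {X : C} {p : X ⟶ A.A} (h : Generates A p)
    {f g : A ⟶ B} (hfg : p ≫ f.f = p ≫ g.f) : f = g := by
  have := h.epi
  ext
  rw [← cancel_epi (freeLift A p), freeLift_comp, freeLift_comp, hfg]

theorem IsPresentation.comp_iso {A B : T.Algebra} {R X : C} {r s : R ⟶ T.obj X} {p : X ⟶ A.A}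
    (h : IsPresentation A r s p) (e : A ≅ B) : IsPresentation B r s (p ≫ e.hom.f) := by
  have := IsReflCoeq.comp_iso h (T.forget.mapIso e)
  unfold IsPresentation
  rw [← freeLift_comp]
  exact this

/-- Both relations are the unit, so the pair is trivial. The redundant `𝟙 X` gives the first
relation the shape `m ≫ η` that `IsPresentation.exists_hom_tensor` expects. -/
theorem isPresentation_free (X : C) :
    IsPresentation (T.free.obj X) (𝟙 X ≫ T.η.app X) (T.η.app X) (T.η.app X) := by
  rw [Category.id_comp]
  have h : freeLift (T.free.obj X) (T.η.app X) = 𝟙 (T.obj X) := T.right_unit X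
  have : IsReflCoeq (kleisliLift (T.η.app X)) (kleisliLift (T.η.app X)) (𝟙 (T.obj X)) := by
    rw [kleisliLift_η]
    exact .refl _
  rw [← h] at this
  exact this

/-- The pair is `T a, μ : T T A ⇉ T A`, with common section `T η`. Its coequalizer `a` is split in
`C` by `η`. -/
theorem isPresentation_self (A : T.Algebra) :
    IsPresentation A (A.a ≫ T.η.app A.A) (𝟙 _) (𝟙 A.A) := by
  have hr : kleisliLift (A.a ≫ T.η.app A.A) = T.map A.a := by
    unfold kleisliLift
    rw [T.map_comp, Category.assoc, T.right_unit]
    exact Category.comp_id _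
  have hs : kleisliLift (𝟙 (T.obj A.A)) = T.μ.app A.A := by
    unfold kleisliLift
    rw [T.map_id, Category.id_comp]
  have hp : freeLift A (𝟙 A.A) = A.a := by
    unfold freeLift
    rw [T.map_id, Category.id_comp]
  unfold IsPresentation
  rw [hr, hs, hp]
  refine ⟨⟨T.map (T.η.app A.A), ?_, T.right_unit _⟩, A.assoc.symm, fun k hk => ?_, ?_⟩
  · rw [← T.map_comp, A.unit, T.map_id]
  · refine ⟨T.η.app A.A ≫ k, ?_⟩
    rw [monad_η_naturality_assoc, hk]
    exact T.left_unit_assoc _ _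
  · exact ⟨fun a b hab => by simpa [A.unit_assoc] using T.η.app A.A ≫= hab⟩

theorem generates_self (A : T.Algebra) : Generates A (𝟙 A.A) := (isPresentation_self A).generates

theorem generates_free (X : C) : Generates (T.free.obj X) (T.η.app X) :=
  (isPresentation_free X).generates

/-- A coequalizer in `C` of a reflexive pair of morphisms of algebras underlies a coequalizer of
algebras. -/
theorem IsReflCoeq.exists_algebra (hT : PreservesReflCoeq T.toFunctor) {P Q : T.Algebra}
    (f g : P ⟶ Q) {Z : C} {q : Q.A ⟶ Z} (h : IsReflCoeq f.f g.f q) :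
    ∃ z : T.obj Z ⟶ Z, T.η.app Z ≫ z = 𝟙 Z ∧ T.μ.app Z ≫ z = T.map z ≫ z ∧
      T.map q ≫ z = Q.a ≫ q := by
  -- `T q` is again a coequalizer, so the structure map of `Q` descends along it. The unit law is
  -- tested on the epimorphism `q`, the associativity law on `T T q`.
  have hTq := hT h
  have hTTq := hT hTq
  have e0 := h.epi
  have e1 := hTq.epi
  have e2 := hTTq.epi
  obtain ⟨z, hz⟩ := hTq.exists_desc (Q.a ≫ q) (by
    rw [f.h_assoc, h.w, g.h_assoc])
  refine ⟨z, ?_, ?_, hz⟩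
  · rw [← cancel_epi q, monad_η_naturality_assoc, hz, Q.unit_assoc, Category.comp_id]
  · rw [← cancel_epi (T.map (T.map q)), monad_μ_naturality_assoc, hz, ← T.map_comp_assoc, hz,
      T.map_comp_assoc, hz, Q.assoc_assoc]

/-- The coequalizer in `C` provides the underlying map. It is a morphism of algebras because `T` of
the quotient map is still epi. -/
theorem IsPresentation.exists_lift (hT : PreservesReflCoeq T.toFunctor) {A W : T.Algebra}
    {R X : C} {r s : R ⟶ T.obj X} {p : X ⟶ A.A} (h : IsPresentation A r s p) (f : X ⟶ W.A)
    (hf : r ≫ (freeLift W f) = s ≫ (freeLift W f)) : ∃ g : A ⟶ W, p ≫ g.f = f := by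
  obtain ⟨l, hl⟩ := h.exists_desc (freeLift W f) (by
    rw [kleisliLift_freeLift, kleisliLift_freeLift, hf])
  have := (hT h).epi
  refine ⟨⟨l, ?_⟩, ?_⟩
  · rw [← cancel_epi (T.map (freeLift A p)), ← T.map_comp_assoc, hl, map_freeLift_a,
      map_freeLift_a_assoc, hl]
  · change p ≫ l = f
    rw [← η_freeLift A p, Category.assoc, hl, η_freeLift]

variable {φ : MonoidalMonadStr M T}

theorem μ_freeLift {A B W : T.Algebra} {X Y : C} (p : X ⟶ A.A) (q : Y ⟶ B.A)
    {k : A.A ⊠[M] B.A ⟶ W.A} (hk : IsBilinear φ k) :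
    φ.lax.μ X Y ≫ freeLift W ((p ⊠ₘ[M] q) ≫ k) =
      (freeLift A p ⊠ₘ[M] freeLift B q) ≫ k := by
  unfold freeLift
  rw [T.map_comp, Category.assoc, ← φ.natural_assoc, hk, mtensor_comp_assoc]

/-- The tensor product of the two presentations is a coequalizer `T R ⊗ T R' ⇉ T X ⊗ T X' ⟶ A ⊗ B`,
so the map `T X ⊗ T X' ⟶ T (X ⊗ X') ⟶ W` induced by `f` descends once it coequalizes the pair.
Bilinearity of the result is tested on the epimorphism `T T X ⊗ T T X' ⟶ T A ⊗ T B`. -/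
theorem IsPresentation.exists_bilinear (hT : PreservesReflCoeq T.toFunctor)
    (hM : PreservesReflCoeq₂ M) (φ : MonoidalMonadStr M T) {A B W : T.Algebra}
    {R X : C} {r s : R ⟶ T.obj X} {p : X ⟶ A.A} (h : IsPresentation A r s p)
    {R' X' : C} {r' s' : R' ⟶ T.obj X'} {p' : X' ⟶ B.A} (h' : IsPresentation B r' s' p')
    (f : X ⊠[M] X' ⟶ W.A)
    (hf : (r ⊠ₘ[M] r') ≫ φ.lax.μ X X' ≫ (freeLift W f) =
      (s ⊠ₘ[M] s') ≫ φ.lax.μ X X' ≫ (freeLift W f)) :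
    ∃ k : A.A ⊠[M] B.A ⟶ W.A, IsBilinear φ k ∧ (p ⊠ₘ[M] p') ≫ k = f := by
  -- Since `μ` is monoidal, each leg of the pair followed by the induced map is determined by its
  -- restriction to `R ⊗ R'`, where `hf` applies.
  have key {R R' : C} (r : R ⟶ T.obj X) (r' : R' ⟶ T.obj X') :
      (kleisliLift r ⊠ₘ[M] kleisliLift r') ≫ φ.lax.μ X X' ≫ freeLift W f =
        φ.lax.μ R R' ≫ freeLift W ((r ⊠ₘ[M] r') ≫ φ.lax.μ X X' ≫ freeLift W f) := by
    unfold kleisliLift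
    rw [← mtensor_comp_assoc, φ.μ_tensor_assoc, φ.natural_assoc, ← map_freeLift_a,
      ← T.map_comp_assoc, ← T.map_comp_assoc, Category.assoc]
    rfl
  obtain ⟨k, hk⟩ := (hM h h').exists_desc (φ.lax.μ X X' ≫ freeLift W f) (by
    rw [key, key, hf])
  have := (hM (hT h) (hT h')).epi
  refine ⟨k, ?_, ?_⟩
  · unfold IsBilinear
    rw [← cancel_epi (T.map (freeLift A p) ⊠ₘ[M] T.map (freeLift B p')), φ.natural_assoc,
      ← T.map_comp_assoc, hk, mtensor_comp_assoc, map_freeLift_a, map_freeLift_a,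
      ← mtensor_comp_assoc, hk, T.map_comp_assoc, map_freeLift_a]
    exact (φ.μ_tensor_assoc _ _ _).symm
  · rw [← η_freeLift A p, ← η_freeLift B p', ← mtensor_comp_assoc, hk, φ.η_tensor_assoc,
      η_freeLift]

/-- The map `T (T X ⊗ T Y) ⟶ T (A ⊗ B) ⟶ U` factors through the one to be shown epi, so it suffices
that the former is epi after `F`. The two variables are treated one at a time, with `Generates`
applied to the composite functors `F ∘ T ∘ (- ⊗ T Y)` and `F ∘ T ∘ (A ⊗ -)`. -/
theorem Generates.tensor (hT : PreservesReflCoeq T.toFunctor) (hM : PreservesReflCoeq₂ M)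
    {A B U : T.Algebra} {X Y : C} {p : X ⟶ A.A} {q : Y ⟶ B.A} (hp : Generates A p)
    (hq : Generates B q) {k : A.A ⊠[M] B.A ⟶ U.A} (hk : IsBilinear φ k) (hg : Generates U k) :
    Generates U ((p ⊠ₘ[M] q) ≫ k) := by
  intro F hF
  have e1 := hp ((hM.tensorRight (T.obj Y)).comp (hT.comp hF))
  have e2 := hq ((hM.tensorLeft A.A).comp (hT.comp hF))
  have e3 := hg hF
  have : F.map (T.map (φ.lax.μ X Y)) ≫ F.map (T.μ.app (X ⊠[M] Y)) ≫
      F.map (freeLift U ((p ⊠ₘ[M] q) ≫ k)) =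
      F.map (T.map (MonoidalCategory.whiskerRight (freeLift A p) (T.obj Y))) ≫
        F.map (T.map (MonoidalCategory.whiskerLeft A.A (freeLift B q))) ≫
          F.map (freeLift U k) := by
    simp only [← F.map_comp]
    rw [← map_freeLift_a, ← T.map_comp_assoc, μ_freeLift p q hk, MonoidalCategory.tensorHom_def,
      Category.assoc, T.map_comp_assoc, T.map_comp_assoc]
    rfl
  have e1' : Epi (F.map (T.map (MonoidalCategory.whiskerRight (freeLift A p) (T.obj Y)))) := e1
  have e2' : Epi (F.map (T.map (MonoidalCategory.whiskerLeft A.A (freeLift B q)))) := e2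
  rw [← Category.assoc] at this
  exact epi_of_epi_fac this

end

/-! ### Universal bilinear maps: existence and presentation -/

section

variable {C : Type u} [Category.{v} C] {M : MonoidalCategory C} {T : Monad C}
  {φ : MonoidalMonadStr M T}

theorem IsBilinear.w_assoc {A B W : T.Algebra} {f : A.A ⊠[M] B.A ⟶ W.A} (hf : IsBilinear φ f)
    {Z : C} (k : W.A ⟶ Z) :
    φ.lax.μ A.A B.A ≫ T.map f ≫ W.a ≫ k = (A.a ⊠ₘ[M] B.a) ≫ f ≫ k := by
  have h : φ.lax.μ A.A B.A ≫ T.map f ≫ W.a = (A.a ⊠ₘ[M] B.a) ≫ f := hf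
  have := h =≫ k
  simpa only [Category.assoc] using this

theorem IsBilinear.comp_hom {A B W W' : T.Algebra} {f : A.A ⊠[M] B.A ⟶ W.A}
    (hf : IsBilinear φ f) (g : W ⟶ W') : IsBilinear φ (f ≫ g.f) := by
  unfold IsBilinear
  rw [T.map_comp, Category.assoc, g.h, hf.w_assoc]

theorem IsBilinear.precomp {A B A' B' W : T.Algebra} {f : A.A ⊠[M] B.A ⟶ W.A}
    (hf : IsBilinear φ f) (g : A' ⟶ A) (h : B' ⟶ B) : IsBilinear φ ((g.f ⊠ₘ[M] h.f) ≫ f) := by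
  unfold IsBilinear
  rw [T.map_comp, Category.assoc, ← φ.natural_assoc, hf, mtensor_comp_assoc, g.h, h.h,
    mtensor_comp_assoc]

/-- The morphism of algebras `T X ⟶ A` induced by `p : X ⟶ A`. -/
def freeHom (A : T.Algebra) {X : C} (p : X ⟶ A.A) : T.free.obj X ⟶ A :=
  ⟨freeLift A p, map_freeLift_a p⟩

/-- A bilinear map out of `T X ⊗ T Y` is recovered from its restriction along `η ⊗ η`, by
bilinearity and the unit law of the monad. -/
theorem isUniversalBilinear_free (φ : MonoidalMonadStr M T) (X Y : C) :
    IsUniversalBilinear φ (A := T.free.obj X) (B := T.free.obj Y) (U := T.free.obj (X ⊠[M] Y))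
      (φ.lax.μ X Y) := by
  have key (W : C) (w : T.obj W ⟶ W) (f : T.obj X ⊠[M] T.obj Y ⟶ W)
      (hf : φ.lax.μ (T.obj X) (T.obj Y) ≫ T.map f ≫ w = (T.μ.app X ⊠ₘ[M] T.μ.app Y) ≫ f) :
      φ.lax.μ X Y ≫ T.map ((T.η.app X ⊠ₘ[M] T.η.app Y) ≫ f) ≫ w = f := by
    rw [T.map_comp, Category.assoc, ← φ.natural_assoc, hf, mtensor_comp_assoc, T.right_unit,
      T.right_unit]
    exact (congrArg (· ≫ f) (mtensor_id _ _)).trans (Category.id_comp f)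
  have key' (W : C) (g : T.obj (X ⊠[M] Y) ⟶ W) (f : T.obj X ⊠[M] T.obj Y ⟶ W)
      (hg : φ.lax.μ X Y ≫ g = f) :
      T.η.app (X ⊠[M] Y) ≫ g = (T.η.app X ⊠ₘ[M] T.η.app Y) ≫ f := by
    rw [← hg, φ.η_tensor_assoc]
  refine ⟨(φ.μ_tensor X Y).symm, fun W f hf => ?_⟩
  refine ⟨freeHom W ((T.η.app X ⊠ₘ[M] T.η.app Y) ≫ f), key W.A W.a f hf, fun g hg => ?_⟩
  exact (generates_free _).hom_ext (p := T.η.app (X ⊠[M] Y))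
    ((key' W.A g.f f hg).trans (η_freeLift W _).symm)

theorem η_kleisliLift {R X : C} (r : R ⟶ T.obj X) : T.η.app R ≫ kleisliLift r = r := by
  unfold kleisliLift
  rw [← monad_η_naturality_assoc, T.left_unit]
  exact Category.comp_id r

/-- The algebra is the coequalizer of `T (T A ⊗ T B) ⇉ T (A ⊗ B)`, a pair with common section `T (η
⊗ η)`. Respecting the relations of this presentation is the same as being bilinear. -/
theorem exists_universal (hC : HasReflexiveCoequalizers C) (hT : PreservesReflCoeq T.toFunctor)
    (φ : MonoidalMonadStr M T) (A B : T.Algebra) :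
    ∃ (U : T.Algebra) (u : A.A ⊠[M] B.A ⟶ U.A), IsUniversalBilinear φ u ∧
      IsPresentation U ((A.a ⊠ₘ[M] B.a) ≫ T.η.app _) (φ.lax.μ A.A B.A) u := by
  have hpair : IsReflexivePair (kleisliLift ((A.a ⊠ₘ[M] B.a) ≫ T.η.app _))
      (kleisliLift (φ.lax.μ A.A B.A)) := by
    refine ⟨T.map (T.η.app A.A ⊠ₘ[M] T.η.app B.A), ?_, ?_⟩
    · unfold kleisliLift
      rw [← T.map_comp_assoc, mtensor_comp_assoc, A.unit, B.unit, mtensor_id, Category.id_comp]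
      exact T.right_unit _
    · unfold kleisliLift
      rw [← T.map_comp_assoc, φ.η_tensor]
      exact T.right_unit _
  obtain ⟨Z, q, hq⟩ := IsReflCoeq.exists_of_hasReflexiveCoequalizers hC _ _ hpair
  obtain ⟨z, hz1, hz2, hz3⟩ := IsReflCoeq.exists_algebra hT
    (freeHom (T.free.obj (A.A ⊠[M] B.A)) ((A.a ⊠ₘ[M] B.a) ≫ T.η.app _))
    (freeHom (T.free.obj (A.A ⊠[M] B.A)) (φ.lax.μ A.A B.A)) (q := q) hq
  let U : T.Algebra := ⟨Z, z, hz1, hz2⟩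
  have hlift : freeLift U (T.η.app _ ≫ q) = q := by
    change T.map (T.η.app _ ≫ q) ≫ z = q
    rw [T.map_comp, Category.assoc]
    refine Eq.trans (T.map (T.η.app (A.A ⊠[M] B.A)) ≫= hz3) ?_
    exact T.right_unit_assoc _ _
  have hpres : IsPresentation U ((A.a ⊠ₘ[M] B.a) ≫ T.η.app _) (φ.lax.μ A.A B.A)
      (T.η.app _ ≫ q) := by
    unfold IsPresentation
    rw [hlift]
    exact hq
  refine ⟨U, T.η.app _ ≫ q, ⟨?_, fun W f hf => ?_⟩, hpres⟩
  -- Restricting the coequalizer equation along `η` gives the bilinearity of the universal map.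
  · have h := T.η.app (T.obj A.A ⊠[M] T.obj B.A) ≫= hpres.w
    rw [← Category.assoc, ← Category.assoc, η_kleisliLift, η_kleisliLift, Category.assoc,
      η_freeLift] at h
    exact h.symm
  · obtain ⟨g, hg⟩ := hpres.exists_lift hT f (by
      rw [Category.assoc, η_freeLift]
      exact hf.symm)
    exact ⟨g, hg, fun g' hg' => hpres.generates.hom_ext (hg'.trans hg.symm)⟩

/-- Universal bilinear maps are unique up to isomorphism, so the presentation of the constructed one
transfers. This is what allows arbitrary choices of tensor products of algebras later on. -/
theorem IsUniversalBilinear.isPresentation (hC : HasReflexiveCoequalizers C)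
    (hT : PreservesReflCoeq T.toFunctor) {A B U : T.Algebra} {u : A.A ⊠[M] B.A ⟶ U.A}
    (hu : IsUniversalBilinear φ u) :
    IsPresentation U ((A.a ⊠ₘ[M] B.a) ≫ T.η.app _) (φ.lax.μ A.A B.A) u := by
  obtain ⟨U', u', hu', hp⟩ := exists_universal hC hT φ A B
  obtain ⟨f, hf, -⟩ := hu'.2 U u hu.1
  obtain ⟨g, hg, -⟩ := hu.2 U' u' hu'.1
  have h1 : f ≫ g = 𝟙 U' := hp.generates.hom_ext (by
    change u' ≫ f.f ≫ g.f = u' ≫ 𝟙 _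
    rw [reassoc_of% hf, hg, Category.comp_id])
  have h2 : g ≫ f = 𝟙 U := (hu.2 U u hu.1).unique (by
    change u ≫ g.f ≫ f.f = u
    rw [reassoc_of% hg, hf]) (Category.comp_id _)
  have := hp.comp_iso ⟨f, g, h1, h2⟩
  rwa [hf] at this

/-- When the first relations come from maps `m`, `m'` between generators, compatibility with the
relations takes the form of a bilinearity condition on `f`. -/
theorem IsPresentation.exists_hom_tensor (hT : PreservesReflCoeq T.toFunctor)
    (hM : PreservesReflCoeq₂ M) {A B U W : T.Algebra}
    {R X : C} {m : R ⟶ X} {s : R ⟶ T.obj X} {p : X ⟶ A.A}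
    (h : IsPresentation A (m ≫ T.η.app X) s p)
    {R' X' : C} {m' : R' ⟶ X'} {s' : R' ⟶ T.obj X'} {p' : X' ⟶ B.A}
    (h' : IsPresentation B (m' ≫ T.η.app X') s' p')
    {u : A.A ⊠[M] B.A ⟶ U.A} (hu : IsUniversalBilinear φ u) (f : X ⊠[M] X' ⟶ W.A)
    (hf : (s ⊠ₘ[M] s') ≫ φ.lax.μ X X' ≫ T.map f ≫ W.a = (m ⊠ₘ[M] m') ≫ f) :
    ∃ g : U ⟶ W, (p ⊠ₘ[M] p') ≫ u ≫ g.f = f := by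
  obtain ⟨k, hk, hk'⟩ := h.exists_bilinear hT hM φ h' f (by
    rw [← mtensor_comp_assoc, φ.η_tensor_assoc, η_freeLift]
    exact hf.symm)
  obtain ⟨g, hg, -⟩ := hu.2 W k hk
  exact ⟨g, by rw [hg, hk']⟩

end

/-! ### Structure morphisms of the tensor product of algebras -/

section

variable {C : Type u} [Category.{v} C] {M : MonoidalCategory C} {T : Monad C}

/-- The category has reflexive coequalizers, and they are preserved by the monad `T` and by the
tensor product of `M`. -/
structure ReflCoeqCompatible (M : MonoidalCategory C) (T : Monad C) : Prop where
  hasReflexiveCoequalizers : HasReflexiveCoequalizers C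
  monad : PreservesReflCoeq T.toFunctor
  tensor : PreservesReflCoeq₂ M

/-- A choice of universal bilinear maps and of a free algebra on the unit object. -/
structure UniversalTensor (φ : MonoidalMonadStr M T) where
  /-- the target of the universal bilinear map -/
  obj (A B : T.Algebra) : T.Algebra
  /-- the universal bilinear map -/
  v (A B : T.Algebra) : A.A ⊠[M] B.A ⟶ (obj A B).A
  universal (A B : T.Algebra) : IsUniversalBilinear φ (v A B)
  /-- the unit algebra, freely generated by the unit object -/
  unit : T.Algebra
  /-- the universal map to the unit algebra -/
  e : unitOf M ⟶ unit.A
  isPresentation_e : IsPresentation unit (𝟙 (unitOf M) ≫ T.η.app _) (T.η.app _) e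

variable {φ : MonoidalMonadStr M T}

theorem mtensor_split_left {A B X A' B' : C} (f : A ⟶ B) (g : B ⟶ X) (h : A' ⟶ B') :
    (f ≫ g) ⊠ₘ[M] h = (f ⊠ₘ[M] 𝟙 A') ≫ (g ⊠ₘ[M] h) := by
  rw [mtensor_comp, Category.id_comp]

theorem mtensor_split_right {A B X A' B' : C} (f : A ⟶ B) (g : B ⟶ X) (h : A' ⟶ B') :
    h ⊠ₘ[M] (f ≫ g) = (𝟙 A' ⊠ₘ[M] f) ≫ (h ⊠ₘ[M] g) := by
  rw [mtensor_comp, Category.id_comp]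

theorem massociator_naturality_assoc {X₁ X₂ X₃ Y₁ Y₂ Y₃ Z : C} (f₁ : X₁ ⟶ Y₁) (f₂ : X₂ ⟶ Y₂)
    (f₃ : X₃ ⟶ Y₃) (k : Y₁ ⊠[M] (Y₂ ⊠[M] Y₃) ⟶ Z) :
    ((f₁ ⊠ₘ[M] f₂) ⊠ₘ[M] f₃) ≫ (M.associator Y₁ Y₂ Y₃).hom ≫ k =
      (M.associator X₁ X₂ X₃).hom ≫ (f₁ ⊠ₘ[M] (f₂ ⊠ₘ[M] f₃)) ≫ k := by
  rw [← Category.assoc, massociator_naturality, Category.assoc]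

theorem massociator_inv_naturality_assoc {X₁ X₂ X₃ Y₁ Y₂ Y₃ Z : C} (f₁ : X₁ ⟶ Y₁)
    (f₂ : X₂ ⟶ Y₂) (f₃ : X₃ ⟶ Y₃) (k : (Y₁ ⊠[M] Y₂) ⊠[M] Y₃ ⟶ Z) :
    (f₁ ⊠ₘ[M] (f₂ ⊠ₘ[M] f₃)) ≫ (M.associator Y₁ Y₂ Y₃).inv ≫ k =
      (M.associator X₁ X₂ X₃).inv ≫ ((f₁ ⊠ₘ[M] f₂) ⊠ₘ[M] f₃) ≫ k := by
  rw [← Category.assoc, massociator_inv_naturality, Category.assoc]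

theorem LaxStr.assoc_inv {D : Type u'} [Category.{v'} D] {M' : MonoidalCategory D} {F : C ⥤ D}
    (L : LaxStr M M' F) (X Y Z : C) :
    (𝟙 (F.obj X) ⊠ₘ[M'] L.μ Y Z) ≫ L.μ X (Y ⊠[M] Z) ≫ F.map (M.associator X Y Z).inv =
      (M'.associator (F.obj X) (F.obj Y) (F.obj Z)).inv ≫ (L.μ X Y ⊠ₘ[M'] 𝟙 (F.obj Z)) ≫
        L.μ (X ⊠[M] Y) Z := by
  rw [Iso.eq_inv_comp, ← reassoc_of% L.assoc X Y Z, ← F.map_comp, Iso.hom_inv_id, F.map_id,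
    Category.comp_id]

/-- The inverse unitor starts at `A` itself, so it is given by a formula in `C` and only has to be
seen to respect the actions. This follows from unitality of `φ` and bilinearity of `k`. -/
theorem map_leftUnitor_inv_a (φ : MonoidalMonadStr M T) {A J U : T.Algebra}
    (e : unitOf M ⟶ J.A) {k : J.A ⊠[M] A.A ⟶ U.A} (hk : IsBilinear φ k) :
    T.map ((M.leftUnitor A.A).inv ≫ (e ⊠ₘ[M] 𝟙 A.A) ≫ k) ≫ U.a =
      A.a ≫ (M.leftUnitor A.A).inv ≫ (e ⊠ₘ[M] 𝟙 A.A) ≫ k := by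
  rw [← cancel_epi (M.leftUnitor (T.obj A.A)).hom]
  conv_lhs => rw [← φ.lax.left_unit A.A, φ.ε_eq]
  rw [← reassoc_of% mleftUnitor_naturality A.a, Category.assoc, Category.assoc, ← T.map_comp_assoc,
    Iso.hom_inv_id_assoc, T.map_comp, Category.assoc, ← φ.natural_assoc, hk,
    mtensor_comp_assoc, mtensor_comp_assoc, mtensor_comp_assoc, T.map_id, Category.assoc,
    ← monad_η_naturality_assoc, J.unit]
  simp only [Category.id_comp, Category.comp_id]

theorem map_rightUnitor_inv_a (φ : MonoidalMonadStr M T) {A J U : T.Algebra}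
    (e : unitOf M ⟶ J.A) {k : A.A ⊠[M] J.A ⟶ U.A} (hk : IsBilinear φ k) :
    T.map ((M.rightUnitor A.A).inv ≫ (𝟙 A.A ⊠ₘ[M] e) ≫ k) ≫ U.a =
      A.a ≫ (M.rightUnitor A.A).inv ≫ (𝟙 A.A ⊠ₘ[M] e) ≫ k := by
  rw [← cancel_epi (M.rightUnitor (T.obj A.A)).hom]
  conv_lhs => rw [← φ.lax.right_unit A.A, φ.ε_eq]
  rw [← reassoc_of% mrightUnitor_naturality A.a, Category.assoc, Category.assoc,
    ← T.map_comp_assoc, Iso.hom_inv_id_assoc, T.map_comp, Category.assoc, ← φ.natural_assoc, hk,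
    mtensor_comp_assoc, mtensor_comp_assoc, mtensor_comp_assoc, T.map_id, Category.assoc,
    Category.assoc,
    ← monad_η_naturality_assoc, J.unit]
  simp only [Category.id_comp, Category.comp_id]

namespace UniversalTensor

variable (E : UniversalTensor φ)

theorem bilinear (A B : T.Algebra) :
    φ.lax.μ A.A B.A ≫ T.map (E.v A B) ≫ (E.obj A B).a = (A.a ⊠ₘ[M] B.a) ≫ E.v A B :=
  (E.universal A B).1

theorem exists_lift {A B W : T.Algebra} (f : A.A ⊠[M] B.A ⟶ W.A) (hf : IsBilinear φ f) :
    ∃ g : E.obj A B ⟶ W, E.v A B ≫ g.f = f := ((E.universal A B).2 W f hf).exists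

theorem hom_ext {A B W : T.Algebra} {f g : E.obj A B ⟶ W} (h : E.v A B ≫ f.f = E.v A B ≫ g.f) :
    f = g :=
  ((E.universal A B).2 W _ ((E.universal A B).1.comp_hom g)).unique h rfl

theorem isPresentation (H : ReflCoeqCompatible M T) (A B : T.Algebra) :
    IsPresentation (E.obj A B) ((A.a ⊠ₘ[M] B.a) ≫ T.η.app _) (φ.lax.μ A.A B.A) (E.v A B) :=
  (E.universal A B).isPresentation H.hasReflexiveCoequalizers H.monad

theorem generates (H : ReflCoeqCompatible M T) {A B : T.Algebra} {X Y : C} {p : X ⟶ A.A}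
    {q : Y ⟶ B.A} (hp : Generates A p) (hq : Generates B q) :
    Generates (E.obj A B) ((p ⊠ₘ[M] q) ≫ E.v A B) :=
  hp.tensor H.monad H.tensor hq (E.universal A B).1 (E.isPresentation H A B).generates

theorem generates_v (H : ReflCoeqCompatible M T) (A B : T.Algebra) :
    Generates (E.obj A B) (E.v A B) := (E.isPresentation H A B).generates

theorem generates_e : Generates E.unit E.e := E.isPresentation_e.generates

theorem exists_hom (H : ReflCoeqCompatible M T) {A B W : T.Algebra}
    {R X : C} {m : R ⟶ X} {s : R ⟶ T.obj X} {p : X ⟶ A.A}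
    (h : IsPresentation A (m ≫ T.η.app X) s p)
    {R' X' : C} {m' : R' ⟶ X'} {s' : R' ⟶ T.obj X'} {p' : X' ⟶ B.A}
    (h' : IsPresentation B (m' ≫ T.η.app X') s' p') (f : X ⊠[M] X' ⟶ W.A)
    (hf : (s ⊠ₘ[M] s') ≫ φ.lax.μ X X' ≫ T.map f ≫ W.a = (m ⊠ₘ[M] m') ≫ f) :
    ∃ g : E.obj A B ⟶ W, (p ⊠ₘ[M] p') ≫ E.v A B ≫ g.f = f :=
  h.exists_hom_tensor H.monad H.tensor h' (E.universal A B) f hf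

theorem exists_map {A B A' B' : T.Algebra} (f : A ⟶ A') (g : B ⟶ B') :
    ∃ h : E.obj A B ⟶ E.obj A' B', E.v A B ≫ h.f = (f.f ⊠ₘ[M] g.f) ≫ E.v A' B' :=
  E.exists_lift _ ((E.universal A' B').1.precomp f g)

/-- The relations are respected because `φ` is associative and the two universal maps on the right
are bilinear. -/
theorem exists_associator_hom (H : ReflCoeqCompatible M T) (A B X : T.Algebra) :
    ∃ h : E.obj (E.obj A B) X ⟶ E.obj A (E.obj B X),
      (E.v A B ⊠ₘ[M] 𝟙 X.A) ≫ E.v (E.obj A B) X ≫ h.f =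
        (M.associator A.A B.A X.A).hom ≫ (𝟙 A.A ⊠ₘ[M] E.v B X) ≫ E.v A (E.obj B X) := by
  refine E.exists_hom H (E.isPresentation H A B) (isPresentation_self X) _ ?_
  rw [T.map_comp, T.map_comp, Category.assoc, Category.assoc, reassoc_of% φ.lax.assoc A.A B.A X.A,
    ← φ.natural_assoc, E.bilinear, mtensor_comp_assoc, mtensor_comp_assoc, Category.assoc,
    Category.assoc, E.bilinear,
    massociator_naturality_assoc, mtensor_comp_assoc, T.map_id, Category.id_comp, Category.comp_id,
    Category.id_comp]

theorem exists_associator_inv (H : ReflCoeqCompatible M T) (A B X : T.Algebra) :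
    ∃ h : E.obj A (E.obj B X) ⟶ E.obj (E.obj A B) X,
      (𝟙 A.A ⊠ₘ[M] E.v B X) ≫ E.v A (E.obj B X) ≫ h.f =
        (M.associator A.A B.A X.A).inv ≫ (E.v A B ⊠ₘ[M] 𝟙 X.A) ≫ E.v (E.obj A B) X := by
  refine E.exists_hom H (isPresentation_self A) (E.isPresentation H B X) _ ?_
  rw [T.map_comp, T.map_comp, Category.assoc, Category.assoc,
    reassoc_of% φ.lax.assoc_inv A.A B.A X.A,
    ← φ.natural_assoc, E.bilinear, mtensor_comp_assoc, mtensor_comp_assoc, Category.assoc,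
    Category.assoc, E.bilinear,
    massociator_inv_naturality_assoc, mtensor_comp_assoc, T.map_id, Category.id_comp,
    Category.comp_id, Category.id_comp]

/-- The condition on the relations is the unitality of `φ`, since `φ_0 = η`. -/
theorem exists_leftUnitor_hom (H : ReflCoeqCompatible M T) (A : T.Algebra) :
    ∃ h : E.obj E.unit A ⟶ A,
      (E.e ⊠ₘ[M] 𝟙 A.A) ≫ E.v E.unit A ≫ h.f =
        (M.leftUnitor A.A).hom := by
  refine E.exists_hom H E.isPresentation_e (isPresentation_self A) _ ?_
  rw [← φ.ε_eq, reassoc_of% φ.lax.left_unit A.A]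
  exact (mleftUnitor_naturality A.a).symm

theorem exists_rightUnitor_hom (H : ReflCoeqCompatible M T) (A : T.Algebra) :
    ∃ h : E.obj A E.unit ⟶ A,
      (𝟙 A.A ⊠ₘ[M] E.e) ≫ E.v A E.unit ≫ h.f =
        (M.rightUnitor A.A).hom := by
  refine E.exists_hom H (isPresentation_self A) E.isPresentation_e _ ?_
  rw [← φ.ε_eq, reassoc_of% φ.lax.right_unit A.A]
  exact (mrightUnitor_naturality A.a).symm

theorem exists_leftUnitor_inv (A : T.Algebra) :
    ∃ h : A ⟶ E.obj E.unit A,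
      h.f = (M.leftUnitor A.A).inv ≫ (E.e ⊠ₘ[M] 𝟙 A.A) ≫
        E.v E.unit A :=
  ⟨⟨_, map_leftUnitor_inv_a φ E.e (E.bilinear E.unit A)⟩, rfl⟩

theorem exists_rightUnitor_inv (A : T.Algebra) :
    ∃ h : A ⟶ E.obj A E.unit,
      h.f = (M.rightUnitor A.A).inv ≫ (𝟙 A.A ⊠ₘ[M] E.e) ≫
        E.v A E.unit :=
  ⟨⟨_, map_rightUnitor_inv_a φ E.e (E.bilinear A E.unit)⟩, rfl⟩

end UniversalTensor

end

/-! ### The monoidal category of algebras -/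

section

variable {C : Type u} [Category.{v} C] {M : MonoidalCategory C} {T : Monad C}
  {φ : MonoidalMonadStr M T}

namespace UniversalTensor

variable (E : UniversalTensor φ)

/-- The action of the tensor product of algebras on morphisms. -/
noncomputable def map {A B A' B' : T.Algebra} (f : A ⟶ A') (g : B ⟶ B') :
    E.obj A B ⟶ E.obj A' B' := (E.exists_map f g).choose

theorem v_map {A B A' B' : T.Algebra} (f : A ⟶ A') (g : B ⟶ B') :
    E.v A B ≫ (E.map f g).f = (f.f ⊠ₘ[M] g.f) ≫ E.v A' B' := (E.exists_map f g).choose_spec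

theorem v_map_assoc {A B A' B' : T.Algebra} (f : A ⟶ A') (g : B ⟶ B') {Z : C}
    (k : (E.obj A' B').A ⟶ Z) :
    E.v A B ≫ (E.map f g).f ≫ k = (f.f ⊠ₘ[M] g.f) ≫ E.v A' B' ≫ k := by
  rw [← Category.assoc, v_map, Category.assoc]

theorem hom_ext₃ (H : ReflCoeqCompatible M T) {A B X W : T.Algebra}
    {f g : E.obj (E.obj A B) X ⟶ W}
    (h : (E.v A B ⊠ₘ[M] 𝟙 X.A) ≫ E.v (E.obj A B) X ≫ f.f =
      (E.v A B ⊠ₘ[M] 𝟙 X.A) ≫ E.v (E.obj A B) X ≫ g.f) : f = g :=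
  (E.generates H (E.generates_v H A B) (generates_self X)).hom_ext
    (by simpa only [Category.assoc] using h)

theorem hom_ext₃' (H : ReflCoeqCompatible M T) {A B X W : T.Algebra}
    {f g : E.obj A (E.obj B X) ⟶ W}
    (h : (𝟙 A.A ⊠ₘ[M] E.v B X) ≫ E.v A (E.obj B X) ≫ f.f =
      (𝟙 A.A ⊠ₘ[M] E.v B X) ≫ E.v A (E.obj B X) ≫ g.f) : f = g :=
  (E.generates H (generates_self A) (E.generates_v H B X)).hom_ext
    (by simpa only [Category.assoc] using h)

/-- The associator of the tensor product of algebras. -/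
noncomputable def associator (H : ReflCoeqCompatible M T) (A B X : T.Algebra) :
    E.obj (E.obj A B) X ≅ E.obj A (E.obj B X) where
  hom := (E.exists_associator_hom H A B X).choose
  inv := (E.exists_associator_inv H A B X).choose
  hom_inv_id := E.hom_ext₃ H (by
    rw [Monad.Algebra.comp_f, reassoc_of% (E.exists_associator_hom H A B X).choose_spec,
      (E.exists_associator_inv H A B X).choose_spec, Iso.hom_inv_id_assoc, Monad.Algebra.id_f,
      Category.comp_id])
  inv_hom_id := E.hom_ext₃' H (by
    rw [Monad.Algebra.comp_f, reassoc_of% (E.exists_associator_inv H A B X).choose_spec,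
      (E.exists_associator_hom H A B X).choose_spec, Iso.inv_hom_id_assoc, Monad.Algebra.id_f,
      Category.comp_id])

theorem v_associator (H : ReflCoeqCompatible M T) (A B X : T.Algebra) :
    (E.v A B ⊠ₘ[M] 𝟙 X.A) ≫ E.v (E.obj A B) X ≫ (E.associator H A B X).hom.f =
      (M.associator A.A B.A X.A).hom ≫ (𝟙 A.A ⊠ₘ[M] E.v B X) ≫ E.v A (E.obj B X) :=
  (E.exists_associator_hom H A B X).choose_spec

/-- The left unitor of the tensor product of algebras. -/
noncomputable def leftUnitor (H : ReflCoeqCompatible M T) (A : T.Algebra) :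
    E.obj E.unit A ≅ A where
  hom := (E.exists_leftUnitor_hom H A).choose
  inv := (E.exists_leftUnitor_inv A).choose
  hom_inv_id := (E.generates H E.generates_e (generates_self A)).hom_ext (by
    rw [Category.assoc, Monad.Algebra.comp_f,
      reassoc_of% (E.exists_leftUnitor_hom H A).choose_spec,
      (E.exists_leftUnitor_inv A).choose_spec, Iso.hom_inv_id_assoc, Monad.Algebra.id_f,
      Category.comp_id])
  inv_hom_id := by
    ext
    rw [Monad.Algebra.comp_f, (E.exists_leftUnitor_inv A).choose_spec, Category.assoc,
      Category.assoc, (E.exists_leftUnitor_hom H A).choose_spec, Iso.inv_hom_id,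
      Monad.Algebra.id_f]

theorem v_leftUnitor (H : ReflCoeqCompatible M T) (A : T.Algebra) :
    (E.e ⊠ₘ[M] 𝟙 A.A) ≫ E.v E.unit A ≫
      (E.leftUnitor H A).hom.f = (M.leftUnitor A.A).hom :=
  (E.exists_leftUnitor_hom H A).choose_spec

/-- The right unitor of the tensor product of algebras. -/
noncomputable def rightUnitor (H : ReflCoeqCompatible M T) (A : T.Algebra) :
    E.obj A E.unit ≅ A where
  hom := (E.exists_rightUnitor_hom H A).choose
  inv := (E.exists_rightUnitor_inv A).choose
  hom_inv_id := (E.generates H (generates_self A) E.generates_e).hom_ext (by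
    rw [Category.assoc, Monad.Algebra.comp_f,
      reassoc_of% (E.exists_rightUnitor_hom H A).choose_spec,
      (E.exists_rightUnitor_inv A).choose_spec, Iso.hom_inv_id_assoc, Monad.Algebra.id_f,
      Category.comp_id])
  inv_hom_id := by
    ext
    rw [Monad.Algebra.comp_f, (E.exists_rightUnitor_inv A).choose_spec, Category.assoc,
      Category.assoc, (E.exists_rightUnitor_hom H A).choose_spec, Iso.inv_hom_id,
      Monad.Algebra.id_f]

theorem v_rightUnitor (H : ReflCoeqCompatible M T) (A : T.Algebra) :
    (𝟙 A.A ⊠ₘ[M] E.e) ≫ E.v A E.unit ≫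
      (E.rightUnitor H A).hom.f = (M.rightUnitor A.A).hom :=
  (E.exists_rightUnitor_hom H A).choose_spec

theorem v_associator_of (H : ReflCoeqCompatible M T) (A B X : T.Algebra) {Y Y' : C}
    (x : Y ⟶ A.A ⊠[M] B.A) (y : Y' ⟶ X.A) :
    ((x ≫ E.v A B) ⊠ₘ[M] y) ≫ E.v (E.obj A B) X ≫ (E.associator H A B X).hom.f =
      (x ⊠ₘ[M] y) ≫ (M.associator A.A B.A X.A).hom ≫ (𝟙 A.A ⊠ₘ[M] E.v B X) ≫
        E.v A (E.obj B X) := by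
  rw [← E.v_associator H A B X, mtensor_comp_assoc, Category.comp_id]

theorem v_associator_of_assoc (H : ReflCoeqCompatible M T) (A B X : T.Algebra) {Y Y' Z : C}
    (x : Y ⟶ A.A ⊠[M] B.A) (y : Y' ⟶ X.A) (k : (E.obj A (E.obj B X)).A ⟶ Z) :
    ((x ≫ E.v A B) ⊠ₘ[M] y) ≫ E.v (E.obj A B) X ≫ (E.associator H A B X).hom.f ≫ k =
      (x ⊠ₘ[M] y) ≫ (M.associator A.A B.A X.A).hom ≫ (𝟙 A.A ⊠ₘ[M] E.v B X) ≫
        E.v A (E.obj B X) ≫ k := by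
  rw [← reassoc_of% E.v_associator H A B X, mtensor_comp_assoc, Category.comp_id]

theorem map_id (A B : T.Algebra) : E.map (𝟙 A) (𝟙 B) = 𝟙 _ :=
  E.hom_ext (by
    rw [v_map, Monad.Algebra.id_f, Monad.Algebra.id_f, Monad.Algebra.id_f, mtensor_id,
      Category.id_comp, Category.comp_id])

theorem map_comp {A B X A' B' X' : T.Algebra} (f : A ⟶ B) (f' : A' ⟶ B') (g : B ⟶ X)
    (g' : B' ⟶ X') : E.map f f' ≫ E.map g g' = E.map (f ≫ g) (f' ≫ g') :=
  E.hom_ext (by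
    rw [Monad.Algebra.comp_f, v_map_assoc, v_map, v_map, mtensor_comp_assoc]
    rfl)

theorem associator_naturality (H : ReflCoeqCompatible M T) {A B X A' B' X' : T.Algebra}
    (f : A ⟶ A') (g : B ⟶ B') (h : X ⟶ X') :
    E.map (E.map f g) h ≫ (E.associator H A' B' X').hom =
      (E.associator H A B X).hom ≫ E.map f (E.map g h) :=
  E.hom_ext₃ H (by
    rw [Monad.Algebra.comp_f, Monad.Algebra.comp_f, v_map_assoc, mtensor_comp_assoc, v_map,
      reassoc_of% E.v_associator H A B X, v_map, mtensor_comp_assoc, v_map,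
      v_associator_of, massociator_naturality_assoc, mtensor_comp_assoc]
    simp only [Category.id_comp, Category.comp_id])

theorem leftUnitor_naturality (H : ReflCoeqCompatible M T) {A B : T.Algebra} (f : A ⟶ B) :
    E.map (𝟙 E.unit) f ≫ (E.leftUnitor H B).hom =
      (E.leftUnitor H A).hom ≫ f :=
  (E.generates H E.generates_e (generates_self A)).hom_ext (by
    rw [Category.assoc, Category.assoc, Monad.Algebra.comp_f, Monad.Algebra.comp_f, v_map_assoc,
      reassoc_of% E.v_leftUnitor H A, mtensor_comp_assoc, ← mleftUnitor_naturality,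
      ← E.v_leftUnitor H B, mtensor_comp_assoc, Monad.Algebra.id_f, Category.id_comp,
      Category.id_comp, Category.comp_id, Category.comp_id])

theorem rightUnitor_naturality (H : ReflCoeqCompatible M T) {A B : T.Algebra} (f : A ⟶ B) :
    E.map f (𝟙 E.unit) ≫ (E.rightUnitor H B).hom =
      (E.rightUnitor H A).hom ≫ f :=
  (E.generates H (generates_self A) E.generates_e).hom_ext (by
    rw [Category.assoc, Category.assoc, Monad.Algebra.comp_f, Monad.Algebra.comp_f, v_map_assoc,
      reassoc_of% E.v_rightUnitor H A, mtensor_comp_assoc, ← mrightUnitor_naturality,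
      ← E.v_rightUnitor H B, mtensor_comp_assoc, Monad.Algebra.id_f, Category.id_comp,
      Category.id_comp, Category.comp_id, Category.comp_id])

theorem pentagon (H : ReflCoeqCompatible M T) (W X Y Z : T.Algebra) :
    E.map (E.associator H W X Y).hom (𝟙 Z) ≫ (E.associator H W (E.obj X Y) Z).hom ≫
        E.map (𝟙 W) (E.associator H X Y Z).hom =
      (E.associator H (E.obj W X) Y Z).hom ≫ (E.associator H W X (E.obj Y Z)).hom :=
  -- Both sides are compared on the generators `((W ⊗ X) ⊗ Y) ⊗ Z`.
  (E.generates H (E.generates H (E.generates_v H W X) (generates_self Y))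
    (generates_self Z)).hom_ext (by
    simp only [Monad.Algebra.comp_f, Category.assoc]
    calc
      _ = (((M.associator W.A X.A Y.A).hom ≫ (𝟙 W.A ⊠ₘ[M] E.v X Y)) ⊠ₘ[M] 𝟙 Z.A) ≫
          (M.associator W.A (E.obj X Y).A Z.A).hom ≫
            (𝟙 W.A ⊠ₘ[M] (E.v (E.obj X Y) Z ≫ (E.associator H X Y Z).hom.f)) ≫
              E.v W (E.obj X (E.obj Y Z)) := by
        rw [v_map_assoc, mtensor_comp_assoc, Category.assoc, v_associator,
          ← Category.assoc (M.associator W.A X.A Y.A).hom,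
          Monad.Algebra.id_f, Category.comp_id, v_associator_of_assoc, v_map, mtensor_comp_assoc,
          Monad.Algebra.id_f, Category.comp_id]
      _ = ((M.associator W.A X.A Y.A).hom ⊠ₘ[M] 𝟙 Z.A) ≫
          (M.associator W.A (X.A ⊠[M] Y.A) Z.A).hom ≫
            (𝟙 W.A ⊠ₘ[M] (M.associator X.A Y.A Z.A).hom) ≫
              (𝟙 W.A ⊠ₘ[M] ((𝟙 X.A ⊠ₘ[M] E.v Y Z) ≫ E.v X (E.obj Y Z))) ≫
                E.v W (E.obj X (E.obj Y Z)) := by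
        rw [mtensor_split_left, Category.assoc, massociator_naturality_assoc, mtensor_comp_assoc,
          v_associator, mtensor_comp_assoc, Category.comp_id]
      _ = (M.associator (W.A ⊠[M] X.A) Y.A Z.A).hom ≫ (M.associator W.A X.A (Y.A ⊠[M] Z.A)).hom ≫
              (𝟙 W.A ⊠ₘ[M] ((𝟙 X.A ⊠ₘ[M] E.v Y Z) ≫ E.v X (E.obj Y Z))) ≫
                E.v W (E.obj X (E.obj Y Z)) := by
        -- The pentagon of `C` enters here; the other steps move universal maps past associators.
        rw [reassoc_of% mpentagon W.A X.A Y.A Z.A]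
      _ = (M.associator (W.A ⊠[M] X.A) Y.A Z.A).hom ≫ (𝟙 _ ⊠ₘ[M] E.v Y Z) ≫
          (E.v W X ⊠ₘ[M] 𝟙 _) ≫ E.v (E.obj W X) (E.obj Y Z) ≫
            (E.associator H W X (E.obj Y Z)).hom.f := by
        rw [v_associator, ← mtensor_id, massociator_naturality_assoc, mtensor_comp_assoc,
          Category.comp_id]
      _ = _ := by
        rw [v_associator_of_assoc, massociator_naturality_assoc, mtensor_comp_assoc,
          mtensor_comp_assoc, mtensor_id, Category.id_comp, Category.comp_id, Category.comp_id,
          Category.id_comp])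

theorem triangle (H : ReflCoeqCompatible M T) (X Y : T.Algebra) :
    (E.associator H X E.unit Y).hom ≫ E.map (𝟙 X) (E.leftUnitor H Y).hom =
      E.map (E.rightUnitor H X).hom (𝟙 Y) :=
  (E.generates H (E.generates H (generates_self X) E.generates_e)
    (generates_self Y)).hom_ext (by
    simp only [Monad.Algebra.comp_f, Category.assoc]
    rw [v_associator_of_assoc, massociator_naturality_assoc, v_map, v_map, mtensor_comp_assoc,
      mtensor_comp_assoc, mtensor_comp_assoc, Category.assoc, Category.assoc, Category.assoc,
      v_rightUnitor,
      v_leftUnitor, Monad.Algebra.id_f, Monad.Algebra.id_f, Category.id_comp, Category.comp_id,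
      Category.comp_id, reassoc_of% mtriangle])

/-- The monoidal structure on algebras determined by a choice of universal bilinear maps. -/
noncomputable abbrev monoidalCategory (H : ReflCoeqCompatible M T) : MonoidalCategory T.Algebra :=
  letI : MonoidalCategoryStruct T.Algebra :=
    { tensorObj := E.obj
      whiskerLeft A _ _ f := E.map (𝟙 A) f
      whiskerRight f A := E.map f (𝟙 A)
      tensorHom f g := E.map f g
      tensorUnit := E.unit
      associator := E.associator H
      leftUnitor := E.leftUnitor H
      rightUnitor := E.rightUnitor H }
  .ofTensorHom
    (id_tensorHom_id := E.map_id)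
    (id_tensorHom := fun _ _ _ _ => rfl)
    (tensorHom_id := fun _ _ => rfl)
    (tensorHom_comp_tensorHom := fun f₁ f₂ g₁ g₂ => E.map_comp f₁ f₂ g₁ g₂)
    (associator_naturality := fun f g h => E.associator_naturality H f g h)
    (leftUnitor_naturality := fun f => E.leftUnitor_naturality H f)
    (rightUnitor_naturality := fun f => E.rightUnitor_naturality H f)
    (pentagon := E.pentagon H)
    (triangle := E.triangle H)

/-- The lax monoidal structure on the forgetful functor given by the universal bilinear maps. -/
noncomputable abbrev laxForget (H : ReflCoeqCompatible M T) :
    LaxStr (E.monoidalCategory H) M T.forget :=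
  letI := E.monoidalCategory H
  { ε := E.e
    μ := E.v
    μ_natural_left {A B} f X := by
      have := E.v_map f (𝟙 X)
      rw [Monad.Algebra.id_f, MonoidalCategory.tensorHom_id] at this
      exact this.symm
    μ_natural_right {A B} X f := by
      have := E.v_map (𝟙 X) f
      rw [Monad.Algebra.id_f, MonoidalCategory.id_tensorHom] at this
      exact this.symm
    associativity A B X := by
      have := E.v_associator H A B X
      rw [MonoidalCategory.id_tensorHom, MonoidalCategory.tensorHom_id] at this
      exact this
    left_unitality A := by
      have := E.v_leftUnitor H A
      rw [MonoidalCategory.tensorHom_id] at this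
      exact this.symm
    right_unitality A := by
      have := E.v_rightUnitor H A
      rw [MonoidalCategory.id_tensorHom] at this
      exact this.symm }

end UniversalTensor

theorem nonempty_algTensor (H : ReflCoeqCompatible M T) (φ : MonoidalMonadStr M T) :
    Nonempty (AlgTensor φ) := by
  choose obj v hv _ using exists_universal H.hasReflexiveCoequalizers H.monad φ
  -- The last entry determines the placeholders: the unit is `T I`, with generator `η`.
  let E : UniversalTensor φ := ⟨obj, v, hv, _, _, isPresentation_free _⟩
  exact ⟨E.monoidalCategory H, E.laxForget H, E.universal, rfl, Category.comp_id _⟩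

end

/-! ### Calculus on generators for an arbitrary tensor product of algebras -/

section

variable {C : Type u} [Category.{v} C] {M : MonoidalCategory C} {T : Monad C}
  {φ : MonoidalMonadStr M T}

namespace AlgTensor

variable (P : AlgTensor φ)

/-- The universal bilinear map. -/
def v (A B : T.Algebra) : A.A ⊠[M] B.A ⟶ (A ⊠[P.mon] B).A := P.lax.μ A B

/-- The universal map to the unit algebra. -/
def e : unitOf M ⟶ (unitOf P.mon).A := P.lax.ε

theorem e_eqToHom : P.e ≫ (eqToHom P.unit_eq).f = T.η.app (unitOf M) := P.ε_eq

/-- The isomorphism given by `unit_eq` carries `η` to `e`, so the unit algebra is free on `e`. -/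
theorem isPresentation_e :
    IsPresentation (unitOf P.mon) (𝟙 (unitOf M) ≫ T.η.app _) (T.η.app _) P.e := by
  have h := (isPresentation_free (T := T) (unitOf M)).comp_iso (eqToIso P.unit_eq.symm)
  have he : P.e = T.η.app (unitOf M) ≫ (eqToIso P.unit_eq.symm).hom.f := by
    have h₁ : (eqToHom P.unit_eq).f ≫ (eqToIso P.unit_eq.symm).hom.f = 𝟙 _ := by
      rw [← Monad.Algebra.comp_f, eqToIso.hom, eqToHom_trans, eqToHom_refl, Monad.Algebra.id_f]
    have h₂ := P.e_eqToHom =≫ (eqToIso P.unit_eq.symm).hom.f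
    rw [Category.assoc, h₁, Category.comp_id] at h₂
    exact h₂
  rw [he]
  exact h

/-- The choice of universal bilinear maps underlying a monoidal structure on algebras. -/
def universalTensor : UniversalTensor φ where
  obj A B := A ⊠[P.mon] B
  v := P.v
  universal := P.universal
  unit := unitOf P.mon
  e := P.e
  isPresentation_e := P.isPresentation_e

theorem hom_ext {A B W : T.Algebra} {f g : A ⊠[P.mon] B ⟶ W}
    (h : P.v A B ≫ f.f = P.v A B ≫ g.f) : f = g := P.universalTensor.hom_ext h

theorem generates_e : Generates (unitOf P.mon) P.e := P.isPresentation_e.generates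

theorem bilinear (A B : T.Algebra) :
    φ.lax.μ A.A B.A ≫ T.map (P.v A B) ≫ (A ⊠[P.mon] B).a = (A.a ⊠ₘ[M] B.a) ≫ P.v A B :=
  (P.universal A B).1

theorem isPresentation (H : ReflCoeqCompatible M T) (A B : T.Algebra) :
    IsPresentation (A ⊠[P.mon] B) ((A.a ⊠ₘ[M] B.a) ≫ T.η.app _) (φ.lax.μ A.A B.A) (P.v A B) :=
  P.universalTensor.isPresentation H A B

theorem generates_v (H : ReflCoeqCompatible M T) (A B : T.Algebra) :
    Generates (A ⊠[P.mon] B) (P.v A B) := P.universalTensor.generates_v H A B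

theorem generates (H : ReflCoeqCompatible M T) {A B : T.Algebra} {X Y : C} {p : X ⟶ A.A}
    {q : Y ⟶ B.A} (hp : Generates A p) (hq : Generates B q) :
    Generates (A ⊠[P.mon] B) ((p ⊠ₘ[M] q) ≫ P.v A B) := P.universalTensor.generates H hp hq

theorem exists_hom (H : ReflCoeqCompatible M T) {A B W : T.Algebra}
    {R X : C} {m : R ⟶ X} {s : R ⟶ T.obj X} {p : X ⟶ A.A}
    (h : IsPresentation A (m ≫ T.η.app X) s p)
    {R' X' : C} {m' : R' ⟶ X'} {s' : R' ⟶ T.obj X'} {p' : X' ⟶ B.A}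
    (h' : IsPresentation B (m' ≫ T.η.app X') s' p') (f : X ⊠[M] X' ⟶ W.A)
    (hf : (s ⊠ₘ[M] s') ≫ φ.lax.μ X X' ≫ T.map f ≫ W.a = (m ⊠ₘ[M] m') ≫ f) :
    ∃ g : A ⊠[P.mon] B ⟶ W, (p ⊠ₘ[M] p') ≫ P.v A B ≫ g.f = f :=
  P.universalTensor.exists_hom H h h' f hf

theorem v_map {A B A' B' : T.Algebra} (f : A ⟶ A') (g : B ⟶ B') :
    P.v A B ≫ (f ⊠ₘ[P.mon] g).f = (f.f ⊠ₘ[M] g.f) ≫ P.v A' B' :=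
  (P.lax.natural f g).symm

theorem v_map_assoc {A B A' B' : T.Algebra} (f : A ⟶ A') (g : B ⟶ B') {Z : C}
    (k : (A' ⊠[P.mon] B').A ⟶ Z) :
    P.v A B ≫ (f ⊠ₘ[P.mon] g).f ≫ k = (f.f ⊠ₘ[M] g.f) ≫ P.v A' B' ≫ k := by
  rw [← Category.assoc, v_map, Category.assoc]

theorem v_associator (A B X : T.Algebra) :
    (P.v A B ⊠ₘ[M] 𝟙 X.A) ≫ P.v (A ⊠[P.mon] B) X ≫ (P.mon.associator A B X).hom.f =
      (M.associator A.A B.A X.A).hom ≫ (𝟙 A.A ⊠ₘ[M] P.v B X) ≫ P.v A (B ⊠[P.mon] X) :=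
  P.lax.assoc A B X

theorem v_associator_of_assoc (A B X : T.Algebra) {Y Y' Z : C}
    (x : Y ⟶ A.A ⊠[M] B.A) (y : Y' ⟶ X.A) (k : (A ⊠[P.mon] (B ⊠[P.mon] X)).A ⟶ Z) :
    ((x ≫ P.v A B) ⊠ₘ[M] y) ≫ P.v (A ⊠[P.mon] B) X ≫ (P.mon.associator A B X).hom.f ≫ k =
      (x ⊠ₘ[M] y) ≫ (M.associator A.A B.A X.A).hom ≫ (𝟙 A.A ⊠ₘ[M] P.v B X) ≫
        P.v A (B ⊠[P.mon] X) ≫ k := by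
  rw [← reassoc_of% P.v_associator A B X, mtensor_comp_assoc, Category.comp_id]

theorem v_associator_of (A B X : T.Algebra) {Y Y' : C}
    (x : Y ⟶ A.A ⊠[M] B.A) (y : Y' ⟶ X.A) :
    ((x ≫ P.v A B) ⊠ₘ[M] y) ≫ P.v (A ⊠[P.mon] B) X ≫ (P.mon.associator A B X).hom.f =
      (x ⊠ₘ[M] y) ≫ (M.associator A.A B.A X.A).hom ≫ (𝟙 A.A ⊠ₘ[M] P.v B X) ≫
        P.v A (B ⊠[P.mon] X) := by
  rw [← P.v_associator A B X, mtensor_comp_assoc, Category.comp_id]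

theorem v_leftUnitor (A : T.Algebra) :
    (P.e ⊠ₘ[M] 𝟙 A.A) ≫ P.v (unitOf P.mon) A ≫ (P.mon.leftUnitor A).hom.f =
      (M.leftUnitor A.A).hom := P.lax.left_unit A

theorem v_rightUnitor (A : T.Algebra) :
    (𝟙 A.A ⊠ₘ[M] P.e) ≫ P.v A (unitOf P.mon) ≫ (P.mon.rightUnitor A).hom.f =
      (M.rightUnitor A.A).hom := P.lax.right_unit A

theorem v_leftUnitor_of (A : T.Algebra) {Y : C} (y : Y ⟶ A.A) :
    (P.e ⊠ₘ[M] y) ≫ P.v (unitOf P.mon) A ≫ (P.mon.leftUnitor A).hom.f =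
      (M.leftUnitor Y).hom ≫ y := by
  rw [← mleftUnitor_naturality, ← v_leftUnitor, mtensor_comp_assoc, Category.id_comp,
    Category.comp_id]

theorem v_rightUnitor_of (A : T.Algebra) {Y : C} (y : Y ⟶ A.A) :
    (y ⊠ₘ[M] P.e) ≫ P.v A (unitOf P.mon) ≫ (P.mon.rightUnitor A).hom.f =
      (M.rightUnitor Y).hom ≫ y := by
  rw [← mrightUnitor_naturality, ← v_rightUnitor, mtensor_comp_assoc, Category.id_comp,
    Category.comp_id]

theorem e_desc {W : T.Algebra} (hT : PreservesReflCoeq T.toFunctor) (f : unitOf M ⟶ W.A) :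
    ∃ g : unitOf P.mon ⟶ W, P.e ≫ g.f = f :=
  P.isPresentation_e.exists_lift hT f (by rw [Category.id_comp])

end AlgTensor

end

/-! ### The duoidal structure on algebras -/

section

variable {C : Type u} [Category.{v} C] {M N : MonoidalCategory C} {D : DuoidalStr M N}
  {T : Monad C} {S : DoubleMonoidalMonadStr D T}

theorem DuoidalStr.ζ_natural_assoc (D : DuoidalStr M N) {A A' B B' X X' Y Y' Z : C}
    (f : A ⟶ A') (g : B ⟶ B') (h : X ⟶ X') (k : Y ⟶ Y')
    (z : (A' ⊠[M] X') ⊠[N] (B' ⊠[M] Y') ⟶ Z) :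
    ((f ⊠ₘ[N] g) ⊠ₘ[M] (h ⊠ₘ[N] k)) ≫ D.ζ A' B' X' Y' ≫ z =
      D.ζ A B X Y ≫ ((f ⊠ₘ[M] h) ⊠ₘ[N] (g ⊠ₘ[M] k)) ≫ z := by
  rw [← Category.assoc, D.ζ_natural, Category.assoc]

/-- The structure maps of the duoidal category of algebras, compatible with those of `C`. -/
structure DuoidalLift (P : AlgTensor S.φ) (Q : AlgTensor S.γ) where
  /-- the interchange law of algebras -/
  ζ (A B X Y : T.Algebra) :
    (A ⊠[Q.mon] B) ⊠[P.mon] (X ⊠[Q.mon] Y) ⟶ (A ⊠[P.mon] X) ⊠[Q.mon] (B ⊠[P.mon] Y)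
  /-- the unit map `I ⟶ I ⋆ I` -/
  δ : unitOf P.mon ⟶ unitOf P.mon ⊠[Q.mon] unitOf P.mon
  /-- the unit map `J ⋄ J ⟶ J` -/
  θ : unitOf Q.mon ⊠[P.mon] unitOf Q.mon ⟶ unitOf Q.mon
  /-- the unit map `I ⟶ J` -/
  ι : unitOf P.mon ⟶ unitOf Q.mon
  v_ζ (A B X Y : T.Algebra) :
    (Q.v A B ⊠ₘ[M] Q.v X Y) ≫ P.v (A ⊠[Q.mon] B) (X ⊠[Q.mon] Y) ≫ (ζ A B X Y).f =
      (D.ζ A.A B.A X.A Y.A ≫ (P.v A X ⊠ₘ[N] P.v B Y)) ≫ Q.v (A ⊠[P.mon] X) (B ⊠[P.mon] Y)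
  e_δ : P.e ≫ δ.f = (D.δ ≫ (P.e ⊠ₘ[N] P.e)) ≫ Q.v (unitOf P.mon) (unitOf P.mon)
  e_θ : (Q.e ⊠ₘ[M] Q.e) ≫ P.v (unitOf Q.mon) (unitOf Q.mon) ≫ θ.f = D.θ ≫ Q.e
  e_ι : P.e ≫ ι.f = D.ι ≫ Q.e

/-- `δ` and `ι` start at the free algebra on `I`, so they extend any map given on the generator. `ζ`
and `θ` start at tensor products and are obtained from presentations of both factors. -/
theorem nonempty_duoidalLift (HM : ReflCoeqCompatible M T) (HN : ReflCoeqCompatible N T)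
    (P : AlgTensor S.φ) (Q : AlgTensor S.γ) : Nonempty (DuoidalLift P Q) := by
  have hζ (A B X Y : T.Algebra) :
      ∃ z : (A ⊠[Q.mon] B) ⊠[P.mon] (X ⊠[Q.mon] Y) ⟶ (A ⊠[P.mon] X) ⊠[Q.mon] (B ⊠[P.mon] Y),
        (Q.v A B ⊠ₘ[M] Q.v X Y) ≫ P.v (A ⊠[Q.mon] B) (X ⊠[Q.mon] Y) ≫ z.f =
          (D.ζ A.A B.A X.A Y.A ≫ (P.v A X ⊠ₘ[N] P.v B Y)) ≫
            Q.v (A ⊠[P.mon] X) (B ⊠[P.mon] Y) := by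
    refine P.exists_hom HM (Q.isPresentation HN A B) (Q.isPresentation HN X Y) _ ?_
    -- The relations of the two `⋆`-products are respected by the compatibility of `φ` and `γ` with
    -- `ζ`, followed by bilinearity of the universal maps for `⋆` and for `⋄`.
    have hi := S.isDoubleMonoidal.interchange A.A B.A X.A Y.A
    rw [Category.assoc, T.map_comp, T.map_comp, Category.assoc, Category.assoc,
      reassoc_of% hi, ← S.γ.natural_assoc, Q.bilinear, mtensor_comp_assoc (M := N),
      mtensor_comp_assoc (M := N),
      Category.assoc, Category.assoc, P.bilinear, P.bilinear, D.ζ_natural_assoc,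
      mtensor_comp_assoc (M := N)]
  have hθ : ∃ t : unitOf Q.mon ⊠[P.mon] unitOf Q.mon ⟶ unitOf Q.mon,
      (Q.e ⊠ₘ[M] Q.e) ≫ P.v (unitOf Q.mon) (unitOf Q.mon) ≫ t.f = D.θ ≫ Q.e := by
    refine P.exists_hom HM Q.isPresentation_e Q.isPresentation_e _ ?_
    -- Both factors are free, so the condition is vacuous up to the monoidality of `η`.
    rw [S.φ.η_tensor_assoc, ← monad_η_naturality_assoc, Monad.Algebra.unit, Category.comp_id]
    exact ((congrArg (· ≫ D.θ ≫ Q.e) (mtensor_id (M := M) _ _)).trans (Category.id_comp _)).symm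
  choose ζ hζ using hζ
  obtain ⟨θ, hθ⟩ := hθ
  obtain ⟨δ, hδ⟩ := P.e_desc HM.monad
    ((D.δ ≫ (P.e ⊠ₘ[N] P.e)) ≫ Q.v (unitOf P.mon) (unitOf P.mon))
  obtain ⟨ι, hι⟩ := P.e_desc HM.monad (D.ι ≫ Q.e)
  exact ⟨ζ, δ, θ, ι, hζ, hδ, hθ, hι⟩

namespace DuoidalLift

variable {P : AlgTensor S.φ} {Q : AlgTensor S.γ} (L : DuoidalLift P Q)

theorem v_ζ_of (A B X Y : T.Algebra) {Z Z' : C} (x : Z ⟶ A.A ⊠[N] B.A) (y : Z' ⟶ X.A ⊠[N] Y.A) :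
    ((x ≫ Q.v A B) ⊠ₘ[M] (y ≫ Q.v X Y)) ≫ P.v (A ⊠[Q.mon] B) (X ⊠[Q.mon] Y) ≫ (L.ζ A B X Y).f =
      ((x ⊠ₘ[M] y) ≫ D.ζ A.A B.A X.A Y.A ≫ (P.v A X ⊠ₘ[N] P.v B Y)) ≫
        Q.v (A ⊠[P.mon] X) (B ⊠[P.mon] Y) := by
  rw [Category.assoc, ← L.v_ζ, mtensor_comp_assoc (M := M)]

theorem v_ζ_of_assoc (A B X Y : T.Algebra) {Z Z' W : C} (x : Z ⟶ A.A ⊠[N] B.A)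
    (y : Z' ⟶ X.A ⊠[N] Y.A) (k : ((A ⊠[P.mon] X) ⊠[Q.mon] (B ⊠[P.mon] Y)).A ⟶ W) :
    ((x ≫ Q.v A B) ⊠ₘ[M] (y ≫ Q.v X Y)) ≫
        P.v (A ⊠[Q.mon] B) (X ⊠[Q.mon] Y) ≫ (L.ζ A B X Y).f ≫ k =
      (x ⊠ₘ[M] y) ≫ D.ζ A.A B.A X.A Y.A ≫ (P.v A X ⊠ₘ[N] P.v B Y) ≫
        Q.v (A ⊠[P.mon] X) (B ⊠[P.mon] Y) ≫ k := by
  have := L.v_ζ_of A B X Y x y =≫ k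
  simpa only [Category.assoc] using this

theorem v_ζ_assoc (A B X Y : T.Algebra) {W : C}
    (k : ((A ⊠[P.mon] X) ⊠[Q.mon] (B ⊠[P.mon] Y)).A ⟶ W) :
    (Q.v A B ⊠ₘ[M] Q.v X Y) ≫
        P.v (A ⊠[Q.mon] B) (X ⊠[Q.mon] Y) ≫ (L.ζ A B X Y).f ≫ k =
      D.ζ A.A B.A X.A Y.A ≫ (P.v A X ⊠ₘ[N] P.v B Y) ≫
        Q.v (A ⊠[P.mon] X) (B ⊠[P.mon] Y) ≫ k := by
  have := L.v_ζ A B X Y =≫ k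
  simpa only [Category.assoc] using this

theorem ζ_natural (HM : ReflCoeqCompatible M T) (HN : ReflCoeqCompatible N T)
    {A A' B B' X X' Y Y' : T.Algebra} (f : A ⟶ A') (g : B ⟶ B') (h : X ⟶ X') (k : Y ⟶ Y') :
    ((f ⊠ₘ[Q.mon] g) ⊠ₘ[P.mon] (h ⊠ₘ[Q.mon] k)) ≫ L.ζ A' B' X' Y' =
      L.ζ A B X Y ≫ ((f ⊠ₘ[P.mon] h) ⊠ₘ[Q.mon] (g ⊠ₘ[P.mon] k)) :=
  (P.generates HM (Q.generates_v HN A B) (Q.generates_v HN X Y)).hom_ext (by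
    simp only [Monad.Algebra.comp_f, Category.assoc]
    rw [P.v_map_assoc, mtensor_comp_assoc (M := M), Q.v_map, Q.v_map, v_ζ_of, v_ζ_assoc, Q.v_map,
      mtensor_comp_assoc (M := N), P.v_map, P.v_map, Category.assoc, Category.assoc,
      D.ζ_natural_assoc,
      mtensor_comp_assoc (M := N)])

theorem ζ_assoc_fst (HM : ReflCoeqCompatible M T) (HN : ReflCoeqCompatible N T)
    (A X B Y Z W : T.Algebra) :
    (L.ζ A X B Y ⊠ₘ[P.mon] 𝟙 (Z ⊠[Q.mon] W)) ≫ L.ζ (A ⊠[P.mon] B) (X ⊠[P.mon] Y) Z W ≫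
        ((P.mon.associator A B Z).hom ⊠ₘ[Q.mon] (P.mon.associator X Y W).hom) =
      (P.mon.associator (A ⊠[Q.mon] X) (B ⊠[Q.mon] Y) (Z ⊠[Q.mon] W)).hom ≫
        (𝟙 (A ⊠[Q.mon] X) ⊠ₘ[P.mon] L.ζ B Y Z W) ≫ L.ζ A X (B ⊠[P.mon] Z) (Y ⊠[P.mon] W) :=
  (P.generates HM (P.generates HM (Q.generates_v HN A X) (Q.generates_v HN B Y))
    (Q.generates_v HN Z W)).hom_ext (by
    simp only [Monad.Algebra.comp_f, Category.assoc]
    calc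
      _ = (D.ζ A.A X.A B.A Y.A ⊠ₘ[M] 𝟙 (Z.A ⊠[N] W.A)) ≫
          D.ζ (A.A ⊠[M] B.A) (X.A ⊠[M] Y.A) Z.A W.A ≫
            ((M.associator A.A B.A Z.A).hom ⊠ₘ[N] (M.associator X.A Y.A W.A).hom) ≫
              (((𝟙 A.A ⊠ₘ[M] P.v B Z) ≫ P.v A (B ⊠[P.mon] Z)) ⊠ₘ[N]
                ((𝟙 X.A ⊠ₘ[M] P.v Y W) ≫ P.v X (Y ⊠[P.mon] W))) ≫
              Q.v (A ⊠[P.mon] (B ⊠[P.mon] Z)) (X ⊠[P.mon] (Y ⊠[P.mon] W)) := by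
        rw [P.v_map_assoc, mtensor_comp_assoc (M := M), Category.assoc, L.v_ζ, Monad.Algebra.id_f,
          Category.comp_id, ← Category.id_comp (Q.v Z W), v_ζ_of_assoc, Q.v_map,
          mtensor_comp_assoc (M := N), mtensor_split_left (M := M), Category.assoc,
          ← mtensor_id (M := N), D.ζ_natural_assoc, mtensor_comp_assoc (M := N), P.v_associator,
          P.v_associator,
          mtensor_comp_assoc (M := N)]
      _ = (M.associator (A.A ⊠[N] X.A) (B.A ⊠[N] Y.A) (Z.A ⊠[N] W.A)).hom ≫
          (𝟙 (A.A ⊠[N] X.A) ⊠ₘ[M] D.ζ B.A Y.A Z.A W.A) ≫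
            D.ζ A.A X.A (B.A ⊠[M] Z.A) (Y.A ⊠[M] W.A) ≫
              (((𝟙 A.A ⊠ₘ[M] P.v B Z) ≫ P.v A (B ⊠[P.mon] Z)) ⊠ₘ[N]
                ((𝟙 X.A ⊠ₘ[M] P.v Y W) ≫ P.v X (Y ⊠[P.mon] W))) ≫
              Q.v (A ⊠[P.mon] (B ⊠[P.mon] Z)) (X ⊠[P.mon] (Y ⊠[P.mon] W)) := by
        -- Once the universal maps have been moved to the end, the law in `C` applies.
        rw [reassoc_of% D.ζ_assoc_fst A.A X.A B.A Y.A Z.A W.A]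
      _ = _ := by
        rw [P.v_associator_of_assoc, P.v_map_assoc, massociator_naturality_assoc (M := M),
          mtensor_comp_assoc (M := M), mtensor_comp_assoc (M := M), Category.assoc,
          Category.assoc, L.v_ζ, Monad.Algebra.id_f,
          Category.comp_id, Category.comp_id, ← Category.id_comp (Q.v A X), v_ζ_of,
          mtensor_split_right (M := M), Category.assoc, Category.assoc, Category.assoc,
          ← mtensor_id (M := N), D.ζ_natural_assoc, mtensor_comp_assoc (M := N)])

theorem ζ_assoc_snd (HM : ReflCoeqCompatible M T) (HN : ReflCoeqCompatible N T)
    (A B Z X Y W : T.Algebra) :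
    L.ζ (A ⊠[Q.mon] B) Z (X ⊠[Q.mon] Y) W ≫ (L.ζ A B X Y ⊠ₘ[Q.mon] 𝟙 (Z ⊠[P.mon] W)) ≫
        (Q.mon.associator (A ⊠[P.mon] X) (B ⊠[P.mon] Y) (Z ⊠[P.mon] W)).hom =
      ((Q.mon.associator A B Z).hom ⊠ₘ[P.mon] (Q.mon.associator X Y W).hom) ≫
        L.ζ A (B ⊠[Q.mon] Z) X (Y ⊠[Q.mon] W) ≫ (𝟙 (A ⊠[P.mon] X) ⊠ₘ[Q.mon] L.ζ B Z Y W) :=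
  -- The generators are `((A ⋆ B) ⋆ Z) ⋄ ((X ⋆ Y) ⋆ W)`.
  (P.generates HM (Q.generates HN (Q.generates_v HN A B) (generates_self Z))
    (Q.generates HN (Q.generates_v HN X Y) (generates_self W))).hom_ext (by
    simp only [Monad.Algebra.comp_f, Category.assoc]
    calc
      _ = D.ζ (A.A ⊠[N] B.A) Z.A (X.A ⊠[N] Y.A) W.A ≫
          (D.ζ A.A B.A X.A Y.A ⊠ₘ[N] 𝟙 (Z.A ⊠[M] W.A)) ≫
            (N.associator (A.A ⊠[M] X.A) (B.A ⊠[M] Y.A) (Z.A ⊠[M] W.A)).hom ≫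
              (P.v A X ⊠ₘ[N] ((P.v B Y ⊠ₘ[N] P.v Z W) ≫ Q.v (B ⊠[P.mon] Y) (Z ⊠[P.mon] W))) ≫
                Q.v (A ⊠[P.mon] X) ((B ⊠[P.mon] Y) ⊠[Q.mon] (Z ⊠[P.mon] W)) := by
        rw [v_ζ_of_assoc, D.ζ_natural_assoc, Q.v_map_assoc, mtensor_comp_assoc (M := N),
          mtensor_comp_assoc (M := N)]
        simp only [Category.assoc]
        rw [L.v_ζ, Q.v_associator_of, mtensor_split_left (M := N), Category.assoc,
          massociator_naturality_assoc (M := N), mtensor_comp_assoc (M := N), mtensor_id (M := M),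
          Monad.Algebra.id_f,
          Category.comp_id, Category.comp_id, Category.id_comp]
      _ = ((N.associator A.A B.A Z.A).hom ⊠ₘ[M] (N.associator X.A Y.A W.A).hom) ≫
          D.ζ A.A (B.A ⊠[N] Z.A) X.A (Y.A ⊠[N] W.A) ≫
            (𝟙 (A.A ⊠[M] X.A) ⊠ₘ[N] D.ζ B.A Z.A Y.A W.A) ≫
              (P.v A X ⊠ₘ[N] ((P.v B Y ⊠ₘ[N] P.v Z W) ≫ Q.v (B ⊠[P.mon] Y) (Z ⊠[P.mon] W))) ≫
                Q.v (A ⊠[P.mon] X) ((B ⊠[P.mon] Y) ⊠[Q.mon] (Z ⊠[P.mon] W)) := by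
        have := D.ζ_assoc_snd A.A B.A Z.A X.A Y.A W.A
        rw [reassoc_of% this]
      _ = _ := by
        rw [P.v_map_assoc, mtensor_comp_assoc (M := M), Category.assoc, Category.assoc,
          Q.v_associator,
          Q.v_associator, ← Category.assoc (N.associator A.A B.A Z.A).hom,
          ← Category.assoc (N.associator X.A Y.A W.A).hom, v_ζ_of_assoc, Q.v_map,
          ← mtensor_comp (M := M), Category.assoc, D.ζ_natural_assoc, mtensor_comp_assoc (M := N),
          mtensor_comp_assoc (M := N), mtensor_comp_assoc (M := N)]
        simp only [Category.assoc]
        rw [L.v_ζ, mtensor_id (M := M), Monad.Algebra.id_f,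
          Category.comp_id, Category.id_comp, Category.assoc])

theorem ζ_left_unit_fst (HM : ReflCoeqCompatible M T) (HN : ReflCoeqCompatible N T)
    (A B : T.Algebra) :
    (L.δ ⊠ₘ[P.mon] 𝟙 (A ⊠[Q.mon] B)) ≫ L.ζ (unitOf P.mon) (unitOf P.mon) A B ≫
      ((P.mon.leftUnitor A).hom ⊠ₘ[Q.mon] (P.mon.leftUnitor B).hom) =
        (P.mon.leftUnitor (A ⊠[Q.mon] B)).hom :=
  (P.generates HM P.generates_e (Q.generates_v HN A B)).hom_ext (by
    simp only [Monad.Algebra.comp_f, Category.assoc]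
    rw [P.v_map_assoc, mtensor_comp_assoc (M := M), L.e_δ, Monad.Algebra.id_f, Category.comp_id,
      P.v_leftUnitor_of]
    -- `v_ζ_of_assoc` needs a composite ending in a universal map in each factor; here the first
    -- part is an identity.
    conv_lhs => rw [← Category.id_comp (Q.v A B)]
    rw [v_ζ_of_assoc, Q.v_map, mtensor_split_left (M := M), Category.assoc, ← mtensor_id (M := N),
      D.ζ_natural_assoc, mtensor_comp_assoc (M := N), mtensor_comp_assoc (M := N),
      mtensor_id (M := N), Category.assoc,
      Category.assoc,
      P.v_leftUnitor, P.v_leftUnitor, reassoc_of% D.ζ_left_unit_fst A.A B.A])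

theorem ζ_right_unit_fst (HM : ReflCoeqCompatible M T) (HN : ReflCoeqCompatible N T)
    (A B : T.Algebra) :
    (𝟙 (A ⊠[Q.mon] B) ⊠ₘ[P.mon] L.δ) ≫ L.ζ A B (unitOf P.mon) (unitOf P.mon) ≫
      ((P.mon.rightUnitor A).hom ⊠ₘ[Q.mon] (P.mon.rightUnitor B).hom) =
        (P.mon.rightUnitor (A ⊠[Q.mon] B)).hom :=
  (P.generates HM (Q.generates_v HN A B) P.generates_e).hom_ext (by
    simp only [Monad.Algebra.comp_f, Category.assoc]
    rw [P.v_map_assoc, mtensor_comp_assoc (M := M), L.e_δ, Monad.Algebra.id_f, Category.comp_id,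
      P.v_rightUnitor_of]
    conv_lhs => rw [← Category.id_comp (Q.v A B)]
    rw [v_ζ_of_assoc, Q.v_map, mtensor_split_right (M := M), Category.assoc, ← mtensor_id (M := N),
      D.ζ_natural_assoc, mtensor_comp_assoc (M := N), mtensor_comp_assoc (M := N),
      mtensor_id (M := N), Category.assoc,
      Category.assoc,
      P.v_rightUnitor, P.v_rightUnitor, reassoc_of% D.ζ_right_unit_fst A.A B.A])

theorem ζ_left_unit_snd (HM : ReflCoeqCompatible M T) (HN : ReflCoeqCompatible N T)
    (A B : T.Algebra) :
    L.ζ (unitOf Q.mon) A (unitOf Q.mon) B ≫ (L.θ ⊠ₘ[Q.mon] 𝟙 (A ⊠[P.mon] B)) ≫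
      (Q.mon.leftUnitor (A ⊠[P.mon] B)).hom =
        (Q.mon.leftUnitor A).hom ⊠ₘ[P.mon] (Q.mon.leftUnitor B).hom :=
  (P.generates HM (Q.generates HN Q.generates_e (generates_self A))
    (Q.generates HN Q.generates_e (generates_self B))).hom_ext (by
    simp only [Monad.Algebra.comp_f, Category.assoc]
    rw [v_ζ_of_assoc, D.ζ_natural_assoc, Q.v_map_assoc, mtensor_comp_assoc (M := N),
      mtensor_comp_assoc (M := N)]
    simp only [Category.assoc]
    rw [L.e_θ, mtensor_id (M := M), Monad.Algebra.id_f, Category.comp_id, Category.id_comp,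
      mtensor_split_left (M := N), Category.assoc, Q.v_leftUnitor_of, P.v_map,
      mtensor_comp_assoc (M := M),
      Category.assoc, Category.assoc, Q.v_leftUnitor, Q.v_leftUnitor,
      ← D.ζ_left_unit_snd A.A B.A]
    simp only [Category.assoc])

theorem ζ_right_unit_snd (HM : ReflCoeqCompatible M T) (HN : ReflCoeqCompatible N T)
    (A B : T.Algebra) :
    L.ζ A (unitOf Q.mon) B (unitOf Q.mon) ≫ (𝟙 (A ⊠[P.mon] B) ⊠ₘ[Q.mon] L.θ) ≫
      (Q.mon.rightUnitor (A ⊠[P.mon] B)).hom =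
        (Q.mon.rightUnitor A).hom ⊠ₘ[P.mon] (Q.mon.rightUnitor B).hom :=
  (P.generates HM (Q.generates HN (generates_self A) Q.generates_e)
    (Q.generates HN (generates_self B) Q.generates_e)).hom_ext (by
    simp only [Monad.Algebra.comp_f, Category.assoc]
    rw [v_ζ_of_assoc, D.ζ_natural_assoc, Q.v_map_assoc, mtensor_comp_assoc (M := N),
      mtensor_comp_assoc (M := N)]
    simp only [Category.assoc]
    rw [L.e_θ, mtensor_id (M := M), Monad.Algebra.id_f, Category.comp_id, Category.id_comp,
      mtensor_split_right (M := N), Category.assoc, Q.v_rightUnitor_of, P.v_map,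
      mtensor_comp_assoc (M := M),
      Category.assoc, Category.assoc, Q.v_rightUnitor, Q.v_rightUnitor,
      ← D.ζ_right_unit_snd A.A B.A]
    simp only [Category.assoc])

theorem θ_assoc (HM : ReflCoeqCompatible M T) :
    (L.θ ⊠ₘ[P.mon] 𝟙 (unitOf Q.mon)) ≫ L.θ =
      (P.mon.associator (unitOf Q.mon) (unitOf Q.mon) (unitOf Q.mon)).hom ≫
        (𝟙 (unitOf Q.mon) ⊠ₘ[P.mon] L.θ) ≫ L.θ :=
  (P.generates HM (P.generates HM Q.generates_e Q.generates_e) Q.generates_e).hom_ext (by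
    simp only [Monad.Algebra.comp_f, Category.assoc]
    rw [P.v_map_assoc, mtensor_comp_assoc (M := M), Category.assoc, L.e_θ, P.v_associator_of_assoc,
      P.v_map_assoc, massociator_naturality_assoc (M := M), mtensor_comp_assoc (M := M),
      mtensor_comp_assoc (M := M),
      Category.assoc, Category.assoc, L.e_θ, Monad.Algebra.id_f, Category.comp_id,
      Category.comp_id, Category.comp_id, mtensor_split_left (M := M) D.θ,
      mtensor_split_right (M := M) D.θ, Category.assoc, Category.assoc,
      L.e_θ, reassoc_of% D.θ_assoc])

theorem ι_θ (HM : ReflCoeqCompatible M T) :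
    (L.ι ⊠ₘ[P.mon] 𝟙 (unitOf Q.mon)) ≫ L.θ = (P.mon.leftUnitor (unitOf Q.mon)).hom :=
  (P.generates HM P.generates_e Q.generates_e).hom_ext (by
    simp only [Monad.Algebra.comp_f, Category.assoc]
    rw [P.v_map_assoc, mtensor_comp_assoc (M := M), L.e_ι, Monad.Algebra.id_f, Category.comp_id,
      P.v_leftUnitor_of, mtensor_split_left (M := M), Category.assoc, L.e_θ, reassoc_of% D.ι_θ])

theorem θ_ι (HM : ReflCoeqCompatible M T) :
    (𝟙 (unitOf Q.mon) ⊠ₘ[P.mon] L.ι) ≫ L.θ = (P.mon.rightUnitor (unitOf Q.mon)).hom :=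
  (P.generates HM Q.generates_e P.generates_e).hom_ext (by
    simp only [Monad.Algebra.comp_f, Category.assoc]
    rw [P.v_map_assoc, mtensor_comp_assoc (M := M), L.e_ι, Monad.Algebra.id_f, Category.comp_id,
      P.v_rightUnitor_of, mtensor_split_right (M := M), Category.assoc, L.e_θ, reassoc_of% D.θ_ι])

/-- The source is the unit algebra, so the comonoid laws are compared on the single generator `e`.
-/
theorem δ_coassoc :
    L.δ ≫ (L.δ ⊠ₘ[Q.mon] 𝟙 (unitOf P.mon)) ≫
        (Q.mon.associator (unitOf P.mon) (unitOf P.mon) (unitOf P.mon)).hom =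
      L.δ ≫ (𝟙 (unitOf P.mon) ⊠ₘ[Q.mon] L.δ) :=
  P.generates_e.hom_ext (by
    simp only [Monad.Algebra.comp_f]
    rw [reassoc_of% L.e_δ, Q.v_map_assoc, mtensor_comp_assoc (M := N), L.e_δ, Q.v_associator_of,
      reassoc_of% L.e_δ, Q.v_map, mtensor_comp_assoc (M := N), L.e_δ, Monad.Algebra.id_f,
      Category.comp_id,
      mtensor_split_left (M := N), Category.assoc, massociator_naturality_assoc (M := N),
      mtensor_comp_assoc (M := N),
      reassoc_of% D.δ_coassoc, mtensor_comp_assoc (M := N)]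
    simp only [Category.assoc, Category.id_comp, Category.comp_id])

theorem δ_ι_left :
    L.δ ≫ (L.ι ⊠ₘ[Q.mon] 𝟙 (unitOf P.mon)) ≫ (Q.mon.leftUnitor (unitOf P.mon)).hom =
      𝟙 (unitOf P.mon) :=
  P.generates_e.hom_ext (by
    simp only [Monad.Algebra.comp_f]
    rw [reassoc_of% L.e_δ, Q.v_map_assoc, mtensor_comp_assoc (M := N), L.e_ι, Monad.Algebra.id_f,
      Category.comp_id, mtensor_split_left (M := N), Category.assoc,
      Q.v_leftUnitor_of, reassoc_of% D.δ_ι_left])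

theorem δ_ι_right :
    L.δ ≫ (𝟙 (unitOf P.mon) ⊠ₘ[Q.mon] L.ι) ≫ (Q.mon.rightUnitor (unitOf P.mon)).hom =
      𝟙 (unitOf P.mon) :=
  P.generates_e.hom_ext (by
    simp only [Monad.Algebra.comp_f]
    rw [reassoc_of% L.e_δ, Q.v_map_assoc, mtensor_comp_assoc (M := N), L.e_ι, Monad.Algebra.id_f,
      Category.comp_id, mtensor_split_right (M := N), Category.assoc,
      Q.v_rightUnitor_of, reassoc_of% D.δ_ι_right])

/-- The duoidal structure on the category of algebras. -/
def duoidalStr (HM : ReflCoeqCompatible M T) (HN : ReflCoeqCompatible N T) :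
    DuoidalStr P.mon Q.mon where
  ζ := L.ζ
  δ := L.δ
  θ := L.θ
  ι := L.ι
  ζ_natural := L.ζ_natural HM HN
  ζ_assoc_fst := L.ζ_assoc_fst HM HN
  ζ_assoc_snd := L.ζ_assoc_snd HM HN
  ζ_left_unit_fst := L.ζ_left_unit_fst HM HN
  ζ_right_unit_fst := L.ζ_right_unit_fst HM HN
  ζ_left_unit_snd := L.ζ_left_unit_snd HM HN
  ζ_right_unit_snd := L.ζ_right_unit_snd HM HN
  θ_assoc := L.θ_assoc HM
  ι_θ := L.ι_θ HM
  θ_ι := L.θ_ι HM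
  δ_coassoc := L.δ_coassoc
  δ_ι_left := L.δ_ι_left
  δ_ι_right := L.δ_ι_right

theorem isDoubleMonoidal_forget (HM : ReflCoeqCompatible M T) (HN : ReflCoeqCompatible N T) :
    IsDoubleMonoidal (L.duoidalStr HM HN) D T.forget P.lax Q.lax where
  interchange A B X Y := (L.v_ζ A B X Y).trans (Category.assoc _ _ _)
  unit_δ := L.e_δ.trans (Category.assoc _ _ _)
  unit_θ := L.e_θ
  unit_ι := L.e_ι

end DuoidalLift

end

/-! ### The free algebra functor is strong monoidal -/

section

variable {C : Type u} [Category.{v} C] {M : MonoidalCategory C} {T : Monad C}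

theorem IsUniversalBilinear.exists_iso {φ : MonoidalMonadStr M T} {A B U U' : T.Algebra}
    {u : A.A ⊠[M] B.A ⟶ U.A} {u' : A.A ⊠[M] B.A ⟶ U'.A} (hu : IsUniversalBilinear φ u)
    (hu' : IsUniversalBilinear φ u') : ∃ i : U ≅ U', u ≫ i.hom.f = u' := by
  obtain ⟨f, hf, -⟩ := hu.2 U' u' hu'.1
  obtain ⟨g, hg, -⟩ := hu'.2 U u hu.1
  have h1 : f ≫ g = 𝟙 U := (hu.2 U u hu.1).unique (by
    change u ≫ f.f ≫ g.f = u
    rw [reassoc_of% hf, hg]) (Category.comp_id _)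
  have h2 : g ≫ f = 𝟙 U' := (hu'.2 U' u' hu'.1).unique (by
    change u' ≫ g.f ≫ f.f = u'
    rw [reassoc_of% hg, hf]) (Category.comp_id _)
  exact ⟨⟨f, g, h1, h2⟩, hf⟩

namespace MonoidalMonadStr

variable (φ : MonoidalMonadStr M T)

/-- The tensorator of `T`, as a map between the carriers of free algebras. -/
def freeμ (X Y : C) : (T.free.obj X).A ⊠[M] (T.free.obj Y).A ⟶ (T.free.obj (X ⊠[M] Y)).A :=
  φ.lax.μ X Y

/-- The unit map of `T`, as a map to the carrier of a free algebra. -/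
def freeε : unitOf M ⟶ (T.free.obj (unitOf M)).A := φ.lax.ε

theorem freeμ_natural {X Y X' Y' : C} (f : X ⟶ Y) (g : X' ⟶ Y') :
    ((T.free.map f).f ⊠ₘ[M] (T.free.map g).f) ≫ φ.freeμ Y Y' =
      φ.freeμ X X' ≫ (T.free.map (f ⊠ₘ[M] g)).f := φ.lax.natural f g

theorem freeμ_assoc (X Y Z : C) :
    (φ.freeμ X Y ⊠ₘ[M] 𝟙 (T.free.obj Z).A) ≫ φ.freeμ (X ⊠[M] Y) Z ≫
        (T.free.map (M.associator X Y Z).hom).f =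
      (M.associator (T.free.obj X).A (T.free.obj Y).A (T.free.obj Z).A).hom ≫
        (𝟙 (T.free.obj X).A ⊠ₘ[M] φ.freeμ Y Z) ≫ φ.freeμ X (Y ⊠[M] Z) := φ.lax.assoc X Y Z

theorem freeμ_left_unit (X : C) :
    (φ.freeε ⊠ₘ[M] 𝟙 (T.free.obj X).A) ≫ φ.freeμ (unitOf M) X ≫
        (T.free.map (M.leftUnitor X).hom).f =
      (M.leftUnitor (T.free.obj X).A).hom := φ.lax.left_unit X

theorem freeμ_right_unit (X : C) :
    (𝟙 (T.free.obj X).A ⊠ₘ[M] φ.freeε) ≫ φ.freeμ X (unitOf M) ≫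
        (T.free.map (M.rightUnitor X).hom).f =
      (M.rightUnitor (T.free.obj X).A).hom := φ.lax.right_unit X

end MonoidalMonadStr

/-- Both `T X ⊗^φ T Y` and `T (X ⊗ Y)` receive a universal bilinear map from `T X ⊗ T Y`, hence are
isomorphic. Composed with the universal maps, the coherence laws become those of `φ`. -/
theorem AlgTensor.exists_isCanonicalFree (H : ReflCoeqCompatible M T) {φ : MonoidalMonadStr M T}
    (P : AlgTensor φ) : ∃ Φ : StrongStr M P.mon T.free, IsCanonicalFree P Φ := by
  choose m hm using fun X Y : C =>
    (P.universal (T.free.obj X) (T.free.obj Y)).exists_iso (isUniversalBilinear_free φ X Y)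
  replace hm (X Y : C) : P.v (T.free.obj X) (T.free.obj Y) ≫ (m X Y).hom.f = φ.freeμ X Y := hm X Y
  have he : P.e ≫ (eqToIso P.unit_eq).hom.f = φ.freeε := P.e_eqToHom.trans φ.ε_eq.symm
  have natural {X Y X' Y' : C} (f : X ⟶ Y) (g : X' ⟶ Y') :
      (T.free.map f ⊠ₘ[P.mon] T.free.map g) ≫ (m Y Y').hom =
        (m X X').hom ≫ T.free.map (f ⊠ₘ[M] g) := P.hom_ext (by
    rw [Monad.Algebra.comp_f, Monad.Algebra.comp_f, P.v_map_assoc, hm, φ.freeμ_natural,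
      reassoc_of% hm])
  have assoc (X Y Z : C) :
      ((m X Y).hom ⊠ₘ[P.mon] 𝟙 (T.free.obj Z)) ≫ (m (X ⊠[M] Y) Z).hom ≫
          T.free.map (M.associator X Y Z).hom =
        (P.mon.associator (T.free.obj X) (T.free.obj Y) (T.free.obj Z)).hom ≫
          (𝟙 (T.free.obj X) ⊠ₘ[P.mon] (m Y Z).hom) ≫ (m X (Y ⊠[M] Z)).hom :=
    P.universalTensor.hom_ext₃ H (by
      change (P.v _ _ ⊠ₘ[M] _) ≫ P.v _ _ ≫ _ = (P.v _ _ ⊠ₘ[M] _) ≫ P.v _ _ ≫ _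
      simp only [Monad.Algebra.comp_f]
      rw [P.v_map_assoc, mtensor_comp_assoc, hm, Monad.Algebra.id_f, Category.comp_id,
        reassoc_of% hm, φ.freeμ_assoc, reassoc_of% P.v_associator (T.free.obj X) (T.free.obj Y),
        P.v_map_assoc, mtensor_comp_assoc, hm, hm, Monad.Algebra.id_f, Category.comp_id])
  have left_unit (X : C) : (P.mon.leftUnitor (T.free.obj X)).hom =
      ((eqToIso P.unit_eq).hom ⊠ₘ[P.mon] 𝟙 (T.free.obj X)) ≫ (m (unitOf M) X).hom ≫
        T.free.map (M.leftUnitor X).hom :=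
    (P.generates H P.generates_e (generates_self _)).hom_ext (by
      simp only [Monad.Algebra.comp_f, Category.assoc]
      rw [P.v_leftUnitor, P.v_map_assoc, mtensor_comp_assoc, he, Monad.Algebra.id_f,
        Category.comp_id, reassoc_of% hm, φ.freeμ_left_unit])
  have right_unit (X : C) : (P.mon.rightUnitor (T.free.obj X)).hom =
      (𝟙 (T.free.obj X) ⊠ₘ[P.mon] (eqToIso P.unit_eq).hom) ≫ (m X (unitOf M)).hom ≫
        T.free.map (M.rightUnitor X).hom :=
    (P.generates H (generates_self _) P.generates_e).hom_ext (by
      simp only [Monad.Algebra.comp_f, Category.assoc]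
      rw [P.v_rightUnitor, P.v_map_assoc, mtensor_comp_assoc, he, Monad.Algebra.id_f,
        Category.comp_id, reassoc_of% hm, φ.freeμ_right_unit])
  let _ := P.mon
  let core : T.free.CoreMonoidal :=
    { εIso := eqToIso P.unit_eq
      μIso := m
      μIso_hom_natural_left f X := by
        rw [← MonoidalCategory.tensorHom_id, ← MonoidalCategory.tensorHom_id, ← T.free.map_id]
        exact natural f (𝟙 X)
      μIso_hom_natural_right X f := by
        rw [← MonoidalCategory.id_tensorHom, ← MonoidalCategory.id_tensorHom, ← T.free.map_id]
        exact natural (𝟙 X) f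
      associativity X Y Z := by
        rw [← MonoidalCategory.tensorHom_id, ← MonoidalCategory.id_tensorHom]
        exact assoc X Y Z
      left_unitality X := by
        rw [← MonoidalCategory.tensorHom_id]
        exact left_unit X
      right_unitality X := by
        rw [← MonoidalCategory.id_tensorHom]
        exact right_unit X }
  exact ⟨core.toMonoidal, hm, he⟩

end

/-! ### Compatibility of the free functor with the duoidal structures -/

section

variable {C : Type u} [Category.{v} C] {M N : MonoidalCategory C} {D : DuoidalStr M N}
  {T : Monad C} {S : DoubleMonoidalMonadStr D T} {P : AlgTensor S.φ} {Q : AlgTensor S.γ}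

/-- On generators each of the four conditions turns into the corresponding condition for the double
monoidal functor `T` (`hS` below), because the structure maps of the free functor restrict to `φ`
and `γ`. -/
theorem DuoidalLift.isDoubleMonoidal_free (L : DuoidalLift P Q) (HM : ReflCoeqCompatible M T)
    (HN : ReflCoeqCompatible N T) {Φ : StrongStr M P.mon T.free} {Γ : StrongStr N Q.mon T.free}
    (hΦ : IsCanonicalFree P Φ) (hΓ : IsCanonicalFree Q Γ) :
    IsDoubleMonoidal D (L.duoidalStr HM HN) T.free Φ.toLaxMonoidal Γ.toLaxMonoidal := by
  have hP (X Y : C) : P.v (T.free.obj X) (T.free.obj Y) ≫ (Φ.μ X Y).f = S.φ.freeμ X Y :=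
    hΦ.μ_eq X Y
  have hQ (X Y : C) : Q.v (T.free.obj X) (T.free.obj Y) ≫ (Γ.μ X Y).f = S.γ.freeμ X Y :=
    hΓ.μ_eq X Y
  have hPe : P.e ≫ Φ.ε.f = S.φ.freeε := hΦ.ε_eq
  have hQe : Q.e ≫ Γ.ε.f = S.γ.freeε := hΓ.ε_eq
  constructor
  · intro A B A' B'
    have hS : (S.γ.freeμ A B ⊠ₘ[M] S.γ.freeμ A' B') ≫ S.φ.freeμ (A ⊠[N] B) (A' ⊠[N] B') ≫
        (T.free.map (D.ζ A B A' B')).f =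
      D.ζ (T.free.obj A).A (T.free.obj B).A (T.free.obj A').A (T.free.obj B').A ≫
        (S.φ.freeμ A A' ⊠ₘ[N] S.φ.freeμ B B') ≫ S.γ.freeμ (A ⊠[M] A') (B ⊠[M] B') :=
      S.isDoubleMonoidal.interchange A B A' B'
    refine (P.generates HM (Q.generates_v HN _ _) (Q.generates_v HN _ _)).hom_ext ?_
    simp only [Monad.Algebra.comp_f, Category.assoc]
    rw [P.v_map_assoc, mtensor_comp_assoc (M := M), hQ, hQ, reassoc_of% hP, hS]
    refine Eq.trans ?_ (L.v_ζ_assoc _ _ _ _ _).symm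
    rw [Q.v_map_assoc, mtensor_comp_assoc (M := N), hP, hP, hQ]
  · have hS : S.φ.freeε ≫ (T.free.map D.δ).f =
        D.δ ≫ (S.φ.freeε ⊠ₘ[N] S.φ.freeε) ≫ S.γ.freeμ _ _ := S.isDoubleMonoidal.unit_δ
    refine P.generates_e.hom_ext ?_
    simp only [Monad.Algebra.comp_f]
    rw [reassoc_of% hPe, hS]
    change _ = P.e ≫ L.δ.f ≫ _
    rw [reassoc_of% L.e_δ, Q.v_map_assoc, mtensor_comp_assoc (M := N), hPe, hQ]
  · have hS : (S.γ.freeε ⊠ₘ[M] S.γ.freeε) ≫ S.φ.freeμ _ _ ≫ (T.free.map D.θ).f =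
        D.θ ≫ S.γ.freeε := S.isDoubleMonoidal.unit_θ
    refine (P.generates HM Q.generates_e Q.generates_e).hom_ext ?_
    simp only [Monad.Algebra.comp_f, Category.assoc]
    rw [P.v_map_assoc, mtensor_comp_assoc (M := M), hQe, reassoc_of% hP, hS]
    change _ = _ ≫ _ ≫ L.θ.f ≫ _
    rw [reassoc_of% L.e_θ, hQe]
  · have hS : S.φ.freeε ≫ (T.free.map D.ι).f = D.ι ≫ S.γ.freeε := S.isDoubleMonoidal.unit_ι
    refine P.generates_e.hom_ext ?_
    simp only [Monad.Algebra.comp_f]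
    rw [reassoc_of% hPe, hS]
    change _ = P.e ≫ L.ι.f ≫ _
    rw [reassoc_of% L.e_ι, hQe]

end

theorem theoremt {C : Type u} [Category.{v} C] {M N : MonoidalCategory C}
    (D : DuoidalStr M N) (T : Monad C) (S : DoubleMonoidalMonadStr D T)
    (hC : HasReflexiveCoequalizers C)
    (hT : Monad.PreservesColimitOfIsReflexivePair T.toFunctor)
    (hM : Monad.PreservesColimitOfIsReflexivePair (@MonoidalCategory.tensor C _ M))
    (hN : Monad.PreservesColimitOfIsReflexivePair (@MonoidalCategory.tensor C _ N)) :
    Nonempty (AlgTensor S.φ) ∧ Nonempty (AlgTensor S.γ) ∧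
    ∀ (P : AlgTensor S.φ) (Q : AlgTensor S.γ),
      ∃ E : DuoidalStr P.mon Q.mon,
        IsDoubleMonoidal E D T.forget P.lax Q.lax ∧
        ∃ (Φ : StrongStr M P.mon T.free) (Γ : StrongStr N Q.mon T.free),
          IsCanonicalFree P Φ ∧ IsCanonicalFree Q Γ ∧
          IsDoubleMonoidal D E T.free Φ.toLaxMonoidal Γ.toLaxMonoidal := by
  have HM : ReflCoeqCompatible M T := ⟨hC, preservesReflCoeq_of_preservesColimit hT,
    preservesReflCoeq₂_of_preservesColimit hM⟩
  have HN : ReflCoeqCompatible N T := ⟨hC, preservesReflCoeq_of_preservesColimit hT,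
    preservesReflCoeq₂_of_preservesColimit hN⟩
  refine ⟨nonempty_algTensor HM S.φ, nonempty_algTensor HN S.γ, fun P Q => ?_⟩
  obtain ⟨L⟩ := nonempty_duoidalLift HM HN P Q
  obtain ⟨Φ, hΦ⟩ := P.exists_isCanonicalFree HM
  obtain ⟨Γ, hΓ⟩ := Q.exists_isCanonicalFree HN
  exact ⟨L.duoidalStr HM HN, L.isDoubleMonoidal_forget HM HN, Φ, Γ, hΦ, hΓ,
    L.isDoubleMonoidal_free HM HN hΦ hΓ⟩
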